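/- Let $(Z,d,\mu)$ be a nonempty complete metric measure space, i.e. $(Z,d)$ is a complete, locally compact metric space and $\mu$ is a locally finite Borel measure on $Z$ with dense support. Let $Q>1$ and suppose that $(Z,d,\mu)$ is Ahlfors $Q$-regular: there is a constant $C\ge 1$ with $$C^{-1}R^Q\le \mu(B(a,R))\le C R^Q$$ for every open ball $B(a,R)=\{z\in Z: d(z,a)<R\}$ with $a\in Z$ and $0<R\le\operatorname{diam}(Z)$ (where $\operatorname{diam}(Z)\in[0,\infty]$). For a family $\Gamma$ of paths in $Z$ let $$\operatorname{Mod}_Q(\Gamma)=\inf_\rho\int_Z\rho^Q\,d\mu\in[0,\infty],$$ where the infimum is over all Borel functions $\rho\colon Z\to[0,\infty]$ such that $\int_\gamma\rho\,ds\ge 1$ for every rectifiable $\gamma\in\Gamma$ (integration with respect to arclength). For $E,F\subseteq Z$ let $\Gamma(E,F)$ be the family of paths in $Z$ connecting $E$ and $F$, and, if $E$ and $F$ have positive diameter, let $$\Delta(E,F)=\frac{\operatorname{dist}(E,F)}{\min\{\operatorname{diam}(E),\operatorname{diam}(F)\}}.$$ Suppose that there exists a positive decreasing (i.e. non-increasing)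 function $\Psi\colon(0,\infty)\to(0,\infty)$ such that $$\operatorname{Mod}_Q(\Gamma(B,B'))\ge\Psi(\Delta(B,B'))$$ whenever $B$ and $B'$ are disjoint open balls in $Z$ with $\Delta(B,B')>0$. Then $(Z,d,\mu)$ is $Q$-Loewner; that is, $Z$ is connected and there exists a positive decreasing function $\Phi\colon(0,\infty)\to(0,\infty)$ such that $$\operatorname{Mod}_Q(\Gamma(E,F))\ge\Phi(\Delta(E,F))$$ whenever $E$ and $F$ are disjoint continua (compact connected sets) in $Z$ with more than one point. -/

import Mathlib

open MeasureTheory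
open scoped ENNReal unitInterval

noncomputable section

namespace MetricMeasure

variable {Z : Type*} [MetricSpace Z]

/-- Ahlfors `Q`-regularity of `(Z, d, μ)`: `C⁻¹ R ^ Q ≤ μ (B(a, R)) ≤ C R ^ Q` for all open balls
with `0 < R ≤ diam Z`, where the diameter may be infinite. -/
def IsAhlforsRegular [MeasurableSpace Z] (Q : ℝ) (μ : Measure Z) : Prop :=
  ∃ C : ℝ, 1 ≤ C ∧ ∀ (a : Z) (R : ℝ), 0 < R → ENNReal.ofReal R ≤ Metric.ediam (Set.univ : Set Z) →
    ENNReal.ofReal (C⁻¹ * R ^ Q) ≤ μ (Metric.ball a R) ∧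
      μ (Metric.ball a R) ≤ ENNReal.ofReal (C * R ^ Q)

/-- The length of a path `γ : [0, 1] → Z`. -/
def pathLength (γ : C(I, Z)) : ℝ≥0∞ := eVariationOn γ Set.univ

/-- A path is rectifiable if its length is finite. -/
def IsRectifiable (γ : C(I, Z)) : Prop := pathLength γ ≠ ∞

/-- The integral `∫_γ ρ ds` of `ρ` along a rectifiable path, computed in the arclength
parametrization of `γ` by the interval `[0, length γ]`. -/
def lineIntegral (ρ : Z → ℝ≥0∞) (γ : C(I, Z)) : ℝ≥0∞ :=
  ∫⁻ t in Set.Icc 0 (pathLength γ).toReal, ρ (naturalParameterization γ Set.univ 0 t)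

/-- A density is a Borel function `ρ : Z → [0, ∞]`; it is admissible for `Γ` if its integral along
every rectifiable path of `Γ` is at least `1`. -/
def IsAdmissible [MeasurableSpace Z] (Γ : Set C(I, Z)) (ρ : Z → ℝ≥0∞) : Prop :=
  Measurable ρ ∧ ∀ γ ∈ Γ, IsRectifiable γ → 1 ≤ lineIntegral ρ γ

/-- The `Q`-modulus of a path family. -/
def modulus [MeasurableSpace Z] (Q : ℝ) (μ : Measure Z) (Γ : Set C(I, Z)) : ℝ≥0∞ :=
  ⨅ (ρ : Z → ℝ≥0∞) (_ : IsAdmissible Γ ρ), ∫⁻ z, ρ z ^ Q ∂μ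

/-- The family `Γ(E, F)` of paths connecting `E` and `F`. -/
def connectingPaths (E F : Set Z) : Set C(I, Z) := {γ | γ 0 ∈ E ∧ γ 1 ∈ F}

/-- The distance between two sets. -/
def setDist (E F : Set Z) : ℝ≥0∞ := ⨅ (x ∈ E) (y ∈ F), edist x y

/-- The relative distance `Δ(E, F) = dist(E, F) / min (diam E) (diam F)`, meant for sets of
positive diameter. -/
def relDist (E F : Set Z) : ℝ :=
  (setDist E F / min (Metric.ediam E) (Metric.ediam F)).toReal

/-- A positive decreasing function `(0, ∞) → (0, ∞)`; values outside `(0, ∞)` are irrelevant. -/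
def IsLoewnerFunction (Ψ : ℝ → ℝ) : Prop :=
  (∀ t, 0 < t → 0 < Ψ t) ∧ AntitoneOn Ψ (Set.Ioi 0)

/-- A nondegenerate continuum: a compact connected set with more than one point. -/
def IsNondegenerateContinuum (E : Set Z) : Prop :=
  IsCompact E ∧ IsConnected E ∧ E.Nontrivial

/-- `(Z, d, μ)` is a `Q`-Loewner space: it is connected, and the modulus of the paths connecting
two disjoint nondegenerate continua is bounded below in terms of their relative distance. -/
def IsLoewner [MeasurableSpace Z] (Q : ℝ) (μ : Measure Z) : Prop :=
  ConnectedSpace Z ∧ ∃ Ψ : ℝ → ℝ, IsLoewnerFunction Ψ ∧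
    ∀ E F : Set Z, IsNondegenerateContinuum E → IsNondegenerateContinuum F → Disjoint E F →
      ENNReal.ofReal (Ψ (relDist E F)) ≤ modulus Q μ (connectingPaths E F)

end MetricMeasure

end

/-! Let `ρ` be admissible for `Γ(E, F)` with `∫ ρ ^ Q` below a small `φ`. A contradiction arises
from a curve between `E` and `F` along which `ρ` has integral less than `1`. The ball condition
gives a cheap path between two balls centred on `E` and on `F`, of radius comparable to the smaller
diameter. This path need not meet `E` or `F`, so two gaps remain, each between two connected sets
that cross a common annulus.

Gaps are bridged by iteration (`exists_curve_between`). If `A` and `B` cross an annulus of radius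
`R` around `z`, choose `x ∈ A` and `y ∈ B` there, about `R` apart, and apply the ball condition to
`B(x, R / n)` and `B(y, R / n)`. The resulting curve leaves two gaps of the same kind, around `x`
and `y`, at scale `R / n`. Since `2 / n < 1`, the lengths in this binary tree are summable, and by
completeness its curves close up, off a null set of times of Cantor type, to one Lipschitz curve
(`GapTree.joinedByCurve`).

The costs must be summable as well. Long paths in `B(z, K * R)` and paths leaving it have small
modulus, by the upper mass bound and `Q > 1`; hence a curve at scale `R` can be chosen with cost at
most a constant times `P(z, R) ^ (1 / Q)`, where `P(z, R)` is the integral of `R / (R + d(z, w))`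
against `ρ ^ Q dμ` (`exists_short_path`). Generation `k` has `2 ^ k` curves, so `P` must decay fast
along the tree. The freedom in choosing `x` and `y` ensures this: over `n` points of `A` whose
distances from `z` are spaced by `R / n`, the kernels at scale `R / n` add up to at most `O(log n)`
times the kernel at scale `R`. Some point therefore has potential at most `η * P(z, R)` with `η =
O(log n / n)` (`exists_potential_le`). For large `n` one has `2 * η ^ (1 / Q) < 1`, and the costs
form a geometric series of sum `O(φ ^ (1 / Q))`.

Connectedness is easier: the upper mass bound excludes isolated points, so the ball condition
applies to small balls around any two distinct points and yields a path between them. -/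

noncomputable section

namespace MetricMeasure

open Set Filter Topology

variable {Z : Type*} [MetricSpace Z]

/-! ### Arclength parametrization of rectifiable paths. -/

section Arclength

variable {γ : C(I, Z)}

lemma IsRectifiable.locallyBoundedVariationOn (h : IsRectifiable γ) :
    LocallyBoundedVariationOn γ univ :=
  BoundedVariationOn.locallyBoundedVariationOn h

lemma univ_inter_Icc_unitInterval : (univ ∩ Icc (0 : I) 1) = univ :=
  eq_univ_of_forall fun t ↦ ⟨mem_univ t, t.2.1, t.2.2⟩

lemma variationOnFromTo_zero_one (γ : C(I, Z)) :
    variationOnFromTo γ univ 0 1 = (pathLength γ).toReal := by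
  rw [variationOnFromTo.eq_of_le _ _ zero_le_one, pathLength, univ_inter_Icc_unitInterval]

/-- The one-sided jumps of the variation function are those of `γ`, which has none. -/
lemma IsRectifiable.continuous_variationOnFromTo (h : IsRectifiable γ) :
    Continuous (variationOnFromTo γ univ 0) := by
  rw [continuous_iff_continuousAt]
  intro b
  have hl := variationOnFromTo.tendsto_left (a := 0) (b := b) (l := γ b) (mem_univ _) (mem_univ _)
    h.locallyBoundedVariationOn ((γ.continuous.tendsto b).mono_left nhdsWithin_le_nhds)
  have hr := variationOnFromTo.tendsto_right (a := 0) (b := b) (l := γ b) (mem_univ _) (mem_univ _)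
    h.locallyBoundedVariationOn ((γ.continuous.tendsto b).mono_left nhdsWithin_le_nhds)
  rw [dist_self, sub_zero, univ_inter] at hl
  rw [dist_self, add_zero, univ_inter] at hr
  exact continuousAt_iff_continuous_left'_right'.2 ⟨hl, hr⟩

lemma IsRectifiable.image_variationOnFromTo (h : IsRectifiable γ) :
    variationOnFromTo γ univ 0 '' univ = Icc 0 (pathLength γ).toReal := by
  have hm := variationOnFromTo.monotoneOn h.locallyBoundedVariationOn (mem_univ (0 : I))
  apply Subset.antisymm
  · rintro _ ⟨t, -, rfl⟩
    refine ⟨variationOnFromTo.nonneg_of_le _ _ t.2.1, ?_⟩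
    rw [← variationOnFromTo_zero_one]
    exact hm (mem_univ _) (mem_univ _) t.2.2
  · rw [← variationOnFromTo_zero_one, ← variationOnFromTo.self γ univ (0 : I), image_univ]
    exact intermediate_value_univ _ _ h.continuous_variationOnFromTo

lemma IsRectifiable.naturalParameterization_variationOnFromTo (h : IsRectifiable γ) (t : I) :
    naturalParameterization γ univ 0 (variationOnFromTo γ univ 0 t) = γ t :=
  edist_eq_zero.1 <| edist_naturalParameterization_eq_zero h.locallyBoundedVariationOn
    (mem_univ _) (mem_univ _)

lemma IsRectifiable.lipschitzOnWith_naturalParameterization (h : IsRectifiable γ) :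
    LipschitzOnWith 1 (naturalParameterization γ univ 0) (Icc 0 (pathLength γ).toReal) := by
  have hu := has_unit_speed_naturalParameterization γ h.locallyBoundedVariationOn (mem_univ (0 : I))
  rw [h.image_variationOnFromTo] at hu
  have key : ∀ x ∈ Icc 0 (pathLength γ).toReal, ∀ y ∈ Icc 0 (pathLength γ).toReal, x ≤ y →
      edist (naturalParameterization γ univ 0 x) (naturalParameterization γ univ 0 y)
        ≤ edist x y := by
    intro x hx y hy hxy
    refine (eVariationOn.edist_le _ (s := Icc 0 (pathLength γ).toReal ∩ Icc x y)
      ⟨hx, le_rfl, hxy⟩ ⟨hy, hxy, le_rfl⟩).trans ?_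
    rw [hu hx hy, edist_comm, edist_dist, Real.dist_eq, abs_of_nonneg (sub_nonneg.2 hxy)]
    simp
  intro x hx y hy
  rw [ENNReal.coe_one, one_mul]
  rcases le_total x y with hxy | hxy
  · exact key x hx y hy hxy
  · rw [edist_comm, edist_comm x y]
    exact key y hy x hx hxy

/-- The arclength parametrization of a path, extended to the real line by constants. -/
def arclengthCurve (γ : C(I, Z)) (t : ℝ) : Z :=
  naturalParameterization γ univ 0
    (projIcc 0 (pathLength γ).toReal ENNReal.toReal_nonneg t : ℝ)

lemma IsRectifiable.lipschitzWith_arclengthCurve (h : IsRectifiable γ) :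
    LipschitzWith 1 (arclengthCurve γ) := by
  have h1 := (lipschitzOnWith_iff_restrict.1 h.lipschitzOnWith_naturalParameterization)
  have h2 := h1.comp (LipschitzWith.projIcc (a := 0) (b := (pathLength γ).toReal)
    ENNReal.toReal_nonneg)
  rw [one_mul] at h2
  exact h2

lemma arclengthCurve_of_mem {t : ℝ} (ht : t ∈ Icc 0 (pathLength γ).toReal) :
    arclengthCurve γ t = naturalParameterization γ univ 0 t := by
  rw [arclengthCurve, projIcc_of_mem _ ht]

lemma IsRectifiable.arclengthCurve_zero (h : IsRectifiable γ) : arclengthCurve γ 0 = γ 0 := by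
  rw [arclengthCurve_of_mem ⟨le_rfl, ENNReal.toReal_nonneg⟩]
  conv_lhs => rw [← variationOnFromTo.self γ univ (0 : I)]
  exact h.naturalParameterization_variationOnFromTo 0

lemma IsRectifiable.arclengthCurve_length (h : IsRectifiable γ) :
    arclengthCurve γ (pathLength γ).toReal = γ 1 := by
  rw [arclengthCurve_of_mem ⟨ENNReal.toReal_nonneg, le_rfl⟩, ← variationOnFromTo_zero_one]
  exact h.naturalParameterization_variationOnFromTo 1

lemma lineIntegral_eq_arclengthCurve (ρ : Z → ℝ≥0∞) (γ : C(I, Z)) :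
    lineIntegral ρ γ = ∫⁻ t in Icc 0 (pathLength γ).toReal, ρ (arclengthCurve γ t) :=
  setLIntegral_congr_fun measurableSet_Icc fun _ ht ↦ by rw [arclengthCurve_of_mem ht]

end Arclength

/-! ### Change of variables inequality for `1`-Lipschitz functions on the line. -/

section Coarea

/-- Lebesgue measure on the line is one-dimensional Hausdorff measure, which a `1`-Lipschitz map
does not increase. -/
lemma volume_le_volume_preimage_of_lipschitzWith {g : ℝ → ℝ} (hg : LipschitzWith 1 g) {A S : Set ℝ}
    (hS : S ⊆ g '' A) : volume S ≤ volume (g ⁻¹' S ∩ A) := by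
  have h1 : S ⊆ g '' (g ⁻¹' S ∩ A) := by
    intro x hx
    obtain ⟨a, ha, rfl⟩ := hS hx
    exact ⟨a, ⟨hx, ha⟩, rfl⟩
  have h2 := hg.hausdorffMeasure_image_le (d := 1) zero_le_one (g ⁻¹' S ∩ A)
  rw [hausdorffMeasure_real] at h2
  simpa using (measure_mono h1).trans h2

lemma setLIntegral_le_setLIntegral_comp {g : ℝ → ℝ} (hg : LipschitzWith 1 g) {A T : Set ℝ}
    (hT : T ⊆ g '' A) {u : ℝ → ℝ≥0∞} (hu : Measurable u) :
    ∫⁻ t in T, u t ≤ ∫⁻ t in A, u (g t) := by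
  rw [← lintegral_map hu hg.continuous.measurable]
  refine lintegral_mono' (Measure.le_intro fun S hS _ ↦ ?_) le_rfl
  rw [Measure.restrict_apply hS, Measure.map_apply hg.continuous.measurable hS,
    Measure.restrict_apply (hg.continuous.measurable hS)]
  refine (volume_le_volume_preimage_of_lipschitzWith hg (inter_subset_right.trans hT)).trans ?_
  exact measure_mono fun x hx ↦ ⟨hx.1.1, hx.2⟩

end Coarea

/-! ### Curves of speed at most `1`: gluing, restriction, slowing down. -/

section LipschitzCurves

/-- Curves of speed at most `1` are stable under gluing and limits; this turns them back into paths.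
Passing to arclength can only lower the integral. -/
lemma exists_path_of_lipschitzWith [MeasurableSpace Z] [BorelSpace Z] {ρ : Z → ℝ≥0∞}
    (hρ : Measurable ρ) {f : ℝ → Z} (hf : LipschitzWith 1 f) {ℓ : ℝ} (hℓ : 0 ≤ ℓ) :
    ∃ γ : C(I, Z), γ 0 = f 0 ∧ γ 1 = f ℓ ∧ IsRectifiable γ ∧
      lineIntegral ρ γ ≤ ∫⁻ t in Icc 0 ℓ, ρ (f t) := by
  set φ : I → ℝ := fun t ↦ ℓ * t with hφ
  have hφm : Monotone φ := fun s t h ↦ mul_le_mul_of_nonneg_left h hℓ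
  have hφc : Continuous φ := by fun_prop
  set γ : C(I, Z) := ⟨f ∘ φ, hf.continuous.comp hφc⟩ with hγ
  have hvar : ∀ s t : I, s ≤ t →
      eVariationOn γ (univ ∩ Icc s t) ≤ ENNReal.ofReal (ℓ * t - ℓ * s) := by
    intro s t hst
    have h1 := (hf.lipschitzOnWith (s := univ)).comp_eVariationOn_le (g := φ)
      (s := univ ∩ Icc s t) (mapsTo_univ _ _)
    rw [ENNReal.coe_one, one_mul] at h1
    refine h1.trans ?_
    exact ((hφm.monotoneOn _).eVariationOn_eq (mem_univ s) (mem_univ t)).le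
  have hrect : IsRectifiable γ := by
    have h := hvar 0 1 zero_le_one
    rw [univ_inter_Icc_unitInterval] at h
    exact ne_top_of_le_ne_top ENNReal.ofReal_ne_top h
  refine ⟨γ, by simp [hγ, hφ], by simp [hγ, hφ], hrect, ?_⟩
  rcases hℓ.eq_or_lt with rfl | hℓ'
  · have h : pathLength γ = 0 := by
      have h := hvar 0 1 zero_le_one
      rw [univ_inter_Icc_unitInterval] at h
      simpa [pathLength] using h
    simp [lineIntegral, h]
  set V : I → ℝ := variationOnFromTo γ univ 0 with hV
  have hVl : ∀ s t : I, s ≤ t → |V s - V t| ≤ ℓ * t - ℓ * s := by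
    intro s t hst
    have h1 := variationOnFromTo.sub_right hrect.locallyBoundedVariationOn (mem_univ (0 : I))
      (mem_univ t) (mem_univ s)
    rw [abs_sub_comm, hV, h1, abs_of_nonneg (variationOnFromTo.nonneg_of_le _ _ hst),
      variationOnFromTo.eq_of_le _ _ hst]
    refine ENNReal.toReal_le_of_le_ofReal ?_ (hvar s t hst)
    exact sub_nonneg.2 (hφm hst)
  -- Arclength as a function of time: `1`-Lipschitz, and it maps `[0, ℓ]` onto `[0, length γ]`.
  set g : ℝ → ℝ := fun s ↦ V (projIcc 0 1 zero_le_one (s / ℓ)) with hg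
  have hVL : ∀ s t : I, |V s - V t| ≤ ℓ * |(s : ℝ) - t| := by
    intro s t
    rcases le_total s t with h | h
    · rw [abs_sub_comm (s : ℝ), abs_of_nonneg (sub_nonneg.2 (Subtype.coe_le_coe.2 h)), mul_sub]
      exact hVl s t h
    · rw [abs_of_nonneg (sub_nonneg.2 (Subtype.coe_le_coe.2 h)), mul_sub, abs_sub_comm]
      exact hVl t s h
  have hgl : LipschitzWith 1 g := by
    refine LipschitzWith.of_dist_le_mul fun s t ↦ ?_
    rw [NNReal.coe_one, one_mul, Real.dist_eq, Real.dist_eq]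
    refine (hVL _ _).trans ?_
    have := (LipschitzWith.projIcc (zero_le_one (α := ℝ))).dist_le_mul (s / ℓ) (t / ℓ)
    rw [NNReal.coe_one, one_mul, Subtype.dist_eq, Real.dist_eq, Real.dist_eq, ← sub_div, abs_div,
      abs_of_pos hℓ'] at this
    calc _ ≤ ℓ * (|s - t| / ℓ) := mul_le_mul_of_nonneg_left this hℓ
      _ = _ := by field_simp
  have himg : Icc 0 (pathLength γ).toReal ⊆ g '' Icc 0 ℓ := by
    rw [← hrect.image_variationOnFromTo]
    rintro _ ⟨t, -, rfl⟩
    refine ⟨ℓ * t, ⟨mul_nonneg hℓ t.2.1, mul_le_of_le_one_right hℓ t.2.2⟩, ?_⟩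
    simp only [hg]
    rw [mul_div_cancel_left₀ _ hℓ'.ne', projIcc_val]
  rw [lineIntegral_eq_arclengthCurve]
  refine (setLIntegral_le_setLIntegral_comp hgl himg
    (hρ.comp hrect.lipschitzWith_arclengthCurve.continuous.measurable)).trans_eq ?_
  refine setLIntegral_congr_fun measurableSet_Icc fun s hs ↦ ?_
  have hs' : s / ℓ ∈ Icc (0 : ℝ) 1 := ⟨div_nonneg hs.1 hℓ, (div_le_one hℓ').2 hs.2⟩
  have hmem : g s ∈ Icc 0 (pathLength γ).toReal := by
    rw [← hrect.image_variationOnFromTo]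
    exact mem_image_of_mem _ (mem_univ _)
  rw [Function.comp_apply, arclengthCurve_of_mem hmem,
    hrect.naturalParameterization_variationOnFromTo, projIcc_of_mem _ hs']
  simp only [hγ, hφ, ContinuousMap.coe_mk, Function.comp_apply]
  rw [mul_div_cancel₀ _ hℓ'.ne']

/-- There is a curve from `p` to `q`, parametrized with speed at most `1` by an interval of length
`ℓ`, along which the integral of `ρ` is at most `c`. -/
def JoinedByCurve (ρ : Z → ℝ≥0∞) (p q : Z) (ℓ : ℝ) (c : ℝ≥0∞) : Prop :=
  ∃ f : ℝ → Z, LipschitzWith 1 f ∧ f 0 = p ∧ f ℓ = q ∧ ∫⁻ t in Icc 0 ℓ, ρ (f t) ≤ c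

/-- Two maps that are `1`-Lipschitz up to additive errors and agree at `a` may be glued at `a`; the
errors add up. -/
lemma dist_ite_le {f g : ℝ → Z} {ε δ : ℝ} (hf : ∀ s t, dist (f s) (f t) ≤ |s - t| + ε)
    (hg : ∀ s t, dist (g s) (g t) ≤ |s - t| + δ) (hε : 0 ≤ ε) (hδ : 0 ≤ δ) {a : ℝ}
    (h : f a = g a) (s t : ℝ) :
    dist (if s ≤ a then f s else g s) (if t ≤ a then f t else g t) ≤ |s - t| + (ε + δ) := by
  wlog hst : s ≤ t generalizing s t
  · rw [dist_comm, abs_sub_comm]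
    exact this t s (le_of_not_ge hst)
  split_ifs with h1 h2 h2
  · exact (hf s t).trans (by linarith)
  · calc dist (f s) (g t) ≤ dist (f s) (f a) + dist (g a) (g t) := by
          rw [h]; exact dist_triangle _ _ _
      _ ≤ (|s - a| + ε) + (|a - t| + δ) := add_le_add (hf _ _) (hg _ _)
      _ = |s - t| + (ε + δ) := by
        rw [abs_of_nonpos (by linarith : s - a ≤ 0), abs_of_nonpos (by linarith : a - t ≤ 0),
          abs_of_nonpos (by linarith : s - t ≤ 0)]
        ring
  · exact absurd (hst.trans h2) h1
  · exact (hg s t).trans (by linarith)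

lemma lipschitzWith_one_iff {f : ℝ → Z} :
    LipschitzWith 1 f ↔ ∀ s t, dist (f s) (f t) ≤ |s - t| + 0 := by
  simp [lipschitzWith_iff_dist_le_mul, Real.dist_eq]

lemma lipschitzWith_ite {f g : ℝ → Z} (hf : LipschitzWith 1 f) (hg : LipschitzWith 1 g) {a : ℝ}
    (h : f a = g a) : LipschitzWith 1 (fun t ↦ if t ≤ a then f t else g t) := by
  rw [lipschitzWith_one_iff] at *
  simpa using dist_ite_le hf hg le_rfl le_rfl h

lemma setLIntegral_Icc_comp_sub (u : ℝ → ℝ≥0∞) (a b c : ℝ) :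
    ∫⁻ t in Icc (a + c) (b + c), u (t - c) = ∫⁻ t in Icc a b, u t := by
  have h := (measurePreserving_sub_right volume c).setLIntegral_comp_preimage_emb
    (MeasurableEquiv.subRight c).measurableEmbedding u (Icc a b)
  rw [← h]
  simp

lemma JoinedByCurve.trans {ρ : Z → ℝ≥0∞} {p q r : Z} {ℓ ℓ' : ℝ} {c c' : ℝ≥0∞} (hℓ : 0 ≤ ℓ)
    (hℓ' : 0 ≤ ℓ') (h : JoinedByCurve ρ p q ℓ c) (h' : JoinedByCurve ρ q r ℓ' c') :
    JoinedByCurve ρ p r (ℓ + ℓ') (c + c') := by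
  obtain ⟨f, hf, hf0, hf1, hfc⟩ := h
  obtain ⟨g, hg, hg0, hg1, hgc⟩ := h'
  have hg' : LipschitzWith 1 (fun t ↦ g (t - ℓ)) := by
    refine LipschitzWith.of_dist_le_mul fun s t ↦ ?_
    simpa using hg.dist_le_mul (s - ℓ) (t - ℓ)
  refine ⟨fun t ↦ if t ≤ ℓ then f t else g (t - ℓ),
    lipschitzWith_ite hf hg' (by simp [hf1, hg0]), by simp [hℓ, hf0], ?_, ?_⟩
  · rcases hℓ'.eq_or_lt with rfl | h
    · simp [hf1, ← hg1, hg0]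
    · simp [h, hg1]
  · rw [← Icc_union_Icc_eq_Icc hℓ (le_add_of_nonneg_right hℓ')]
    refine (lintegral_union_le _ _ _).trans (add_le_add ?_ ?_)
    · refine le_trans (le_of_eq ?_) hfc
      exact setLIntegral_congr_fun measurableSet_Icc fun t ht ↦ by simp [ht.2]
    · refine le_trans (le_of_eq ?_) hgc
      rw [← setLIntegral_Icc_comp_sub (fun t ↦ ρ (g t)) 0 ℓ' ℓ, zero_add, add_comm ℓ' ℓ]
      refine setLIntegral_congr_fun measurableSet_Icc fun t ht ↦ ?_
      rcases ht.1.eq_or_lt with rfl | h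
      · simp [hf1, hg0]
      · simp only [if_neg h.not_ge]

/-- A curve may be restricted to a subinterval, possibly reversed, and slowed down. -/
lemma joinedByCurve_of_lipschitzWith (ρ : Z → ℝ≥0∞) {f : ℝ → Z}
    (hf : LipschitzWith 1 f) {ℓ ℓ' s t : ℝ} (hs : s ∈ Icc 0 ℓ) (ht : t ∈ Icc 0 ℓ) (hst : s ≠ t)
    (hℓ' : |t - s| ≤ ℓ') :
    JoinedByCurve ρ (f s) (f t) ℓ'
      (ENNReal.ofReal (ℓ' / |t - s|) * ∫⁻ τ in Icc 0 ℓ, ρ (f τ)) := by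
  have hv : 0 < |t - s| := abs_pos.2 (sub_ne_zero.2 hst.symm)
  have hpos : 0 < ℓ' := hv.trans_le hℓ'
  set a : ℝ := (t - s) / ℓ' with ha
  have ha0 : a ≠ 0 := div_ne_zero (sub_ne_zero.2 hst.symm) hpos.ne'
  have haa : |a| = |t - s| / ℓ' := by rw [ha, abs_div, abs_of_pos hpos]
  refine ⟨fun τ ↦ f (s + a * τ), ?_, by simp, ?_, ?_⟩
  · refine LipschitzWith.of_dist_le_mul fun x y ↦ ?_
    refine (hf.dist_le_mul _ _).trans ?_
    rw [NNReal.coe_one, one_mul, one_mul, Real.dist_eq, Real.dist_eq,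
      show s + a * x - (s + a * y) = a * (x - y) by ring, abs_mul]
    refine mul_le_of_le_one_left (abs_nonneg _) ?_
    rw [haa]
    exact (div_le_one hpos).2 hℓ'
  · simp only
    rw [ha, div_mul_cancel₀ _ hpos.ne']
    congr 1
    ring
  · have hemb : MeasurableEmbedding (fun τ : ℝ ↦ s + a * τ) :=
      ((Homeomorph.mulLeft₀ a ha0).trans (Homeomorph.addLeft s)).measurableEmbedding
    have hmap : Measure.map (fun τ : ℝ ↦ s + a * τ) volume = ENNReal.ofReal |a⁻¹| • volume := by
      have h1 : (fun τ : ℝ ↦ s + a * τ) = (fun x ↦ s + x) ∘ (fun τ ↦ a * τ) := rfl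
      rw [h1, ← Measure.map_map (by fun_prop) (by fun_prop), Real.map_volume_mul_left ha0,
        Measure.map_smul, (measurePreserving_add_left volume s).map_eq]
    calc ∫⁻ τ in Icc 0 ℓ', ρ (f (s + a * τ))
        ≤ ∫⁻ τ in (fun τ : ℝ ↦ s + a * τ) ⁻¹' Icc 0 ℓ, ρ (f (s + a * τ)) := by
          refine lintegral_mono_set fun τ hτ ↦ ?_
          have h1 : s + a * τ = (1 - τ / ℓ') * s + (τ / ℓ') * t := by
            rw [ha]; field_simp; ring
          rw [mem_preimage, h1]
          have h2 : τ / ℓ' ≤ 1 := (div_le_one hpos).2 hτ.2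
          exact (convex_Icc 0 ℓ) hs ht (by linarith) (div_nonneg hτ.1 hpos.le) (by ring)
      _ = ∫⁻ τ in Icc 0 ℓ, ρ (f τ) ∂(Measure.map (fun τ : ℝ ↦ s + a * τ) volume) :=
          by rw [hemb.restrict_map, hemb.lintegral_map]
      _ = _ := by
          rw [hmap, Measure.restrict_smul, lintegral_smul_measure, abs_inv, haa, inv_div,
            smul_eq_mul]

end LipschitzCurves

/-! ### Limits of curves with gaps filled in along a binary tree. -/

/-- A binary tree of gaps. The gap `G` of level `n` is to be bridged by a curve from `src G` to
`tgt G`. The middle part `mid G` of this curve is given, has length at most `ℓ * lam ^ n` and goes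
from the target of the left child of `G` to the source of its right child, so that there remain two
gaps of level `n + 1`. -/
structure GapTree (N : Type*) (ρ : Z → ℝ≥0∞) (ℓ d lam : ℝ) (c : ℕ → ℝ≥0∞) where
  level : N → ℕ
  left : N → N
  right : N → N
  src : N → Z
  tgt : N → Z
  mid : N → ℝ → Z
  level_left : ∀ G, level (left G) = level G + 1
  level_right : ∀ G, level (right G) = level G + 1
  src_left : ∀ G, src (left G) = src G
  tgt_right : ∀ G, tgt (right G) = tgt G
  dist_le : ∀ G, dist (src G) (tgt G) ≤ d * lam ^ level G
  lipschitz_mid : ∀ G, LipschitzWith 1 (mid G)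
  mid_zero : ∀ G, mid G 0 = tgt (left G)
  mid_length : ∀ G, mid G (ℓ * lam ^ level G) = src (right G)
  lintegral_mid_le : ∀ G, ∫⁻ t in Icc 0 (ℓ * lam ^ level G), ρ (mid G t) ≤ c (level G)

namespace GapTree

/-- The length of the time interval used to bridge a gap of level `n`. -/
def gapTime (ℓ lam : ℝ) (n : ℕ) : ℝ := ℓ / (1 - 2 * lam) * lam ^ n

/-- The time at which the right child of a gap of level `n` is entered. -/
def rightTime (ℓ lam : ℝ) (n : ℕ) : ℝ := gapTime ℓ lam (n + 1) + ℓ * lam ^ n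

section

variable {ℓ lam : ℝ}

lemma gapTime_pos (hℓ : 0 < ℓ) (h0 : 0 < lam) (h1 : 2 * lam < 1) (n : ℕ) :
    0 < gapTime ℓ lam n :=
  mul_pos (div_pos hℓ (by linarith)) (pow_pos h0 n)

/-- The time for a gap is the time for its left child, its middle part and its right child; the
factor `1 / (1 - 2 * lam)` is the solution of this recursion. -/
lemma gapTime_eq (h1 : 2 * lam < 1) (n : ℕ) :
    gapTime ℓ lam n = rightTime ℓ lam n + gapTime ℓ lam (n + 1) := by
  have : 1 - 2 * lam ≠ 0 := by linarith
  rw [rightTime, gapTime, gapTime, pow_succ]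
  field_simp
  ring

/-- The part of the time interval `[0, gapTime n]` that is not covered by the middle parts of the
gaps in `m` generations. -/
def residual (ℓ lam : ℝ) : ℕ → ℕ → Set ℝ
  | 0, n => Icc 0 (gapTime ℓ lam n)
  | m + 1, n => residual ℓ lam m (n + 1) ∪
      (fun t ↦ t - rightTime ℓ lam n) ⁻¹' residual ℓ lam m (n + 1)

lemma measurableSet_residual (m : ℕ) : ∀ n, MeasurableSet (residual ℓ lam m n) := by
  induction m with
  | zero => exact fun n ↦ measurableSet_Icc
  | succ m ih =>
    exact fun n ↦ (ih _).union ((measurable_id.sub_const (rightTime ℓ lam n)) (ih (n + 1)))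

lemma volume_residual_le (m : ℕ) : ∀ n,
    volume (residual ℓ lam m n) ≤ 2 ^ m * ENNReal.ofReal (gapTime ℓ lam (n + m)) := by
  induction m with
  | zero => intro n; simp [residual]
  | succ m ih =>
    intro n
    refine (measure_union_le _ _).trans ?_
    rw [(measurePreserving_sub_right volume (rightTime ℓ lam n)).measure_preimage
      (measurableSet_residual m _).nullMeasurableSet]
    refine (add_le_add (ih (n + 1)) (ih (n + 1))).trans_eq ?_
    rw [show n + 1 + m = n + (m + 1) by ring, pow_succ]
    ring

lemma residual_succ_subset (hℓ : 0 < ℓ) (h0 : 0 < lam) (h1 : 2 * lam < 1) (m : ℕ) : ∀ n,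
    residual ℓ lam (m + 1) n ⊆ residual ℓ lam m n := by
  induction m with
  | zero =>
    rintro n t (⟨ht0, ht1⟩ | ⟨ht0, ht1⟩)
    all_goals
      have := gapTime_eq (ℓ := ℓ) h1 n
      have hp := gapTime_pos hℓ h0 h1 (n + 1)
      have hq : 0 < rightTime ℓ lam n := add_pos hp (mul_pos hℓ (pow_pos h0 n))
      constructor <;> linarith
  | succ m ih =>
    exact fun n ↦ union_subset_union (ih (n + 1)) (preimage_mono (ih (n + 1)))

end

variable {N : Type*} {ρ : Z → ℝ≥0∞} {ℓ d lam : ℝ} {c : ℕ → ℝ≥0∞} (T : GapTree N ρ ℓ d lam c)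

/-- Bridging a gap by the curves of `m` generations, with jumps at the remaining gaps. -/
def approx (T : GapTree N ρ ℓ d lam c) : ℕ → N → ℝ → Z
  | 0, G, t => if t < gapTime ℓ lam (T.level G) then T.src G else T.tgt G
  | m + 1, G, t =>
    if t ≤ gapTime ℓ lam (T.level G + 1) then approx T m (T.left G) t
    else if t ≤ rightTime ℓ lam (T.level G) then T.mid G (t - gapTime ℓ lam (T.level G + 1))
    else approx T m (T.right G) (t - rightTime ℓ lam (T.level G))

lemma approx_of_nonpos (hℓ : 0 < ℓ) (h0 : 0 < lam) (h1 : 2 * lam < 1) {t : ℝ} (ht : t ≤ 0)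
    (m : ℕ) : ∀ G, T.approx m G t = T.src G := by
  induction m with
  | zero => intro G; simp [approx, ht.trans_lt (gapTime_pos hℓ h0 h1 _)]
  | succ m ih => intro G; simp [approx, ht.trans (gapTime_pos hℓ h0 h1 _).le, ih, T.src_left]

lemma approx_of_ge (hℓ : 0 < ℓ) (h0 : 0 < lam) (h1 : 2 * lam < 1) (m : ℕ) : ∀ G t,
    gapTime ℓ lam (T.level G) ≤ t → T.approx m G t = T.tgt G := by
  induction m with
  | zero => intro G t ht; simp [approx, ht]
  | succ m ih =>
    intro G t ht
    have h2 := gapTime_eq (ℓ := ℓ) h1 (T.level G)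
    have h3 := gapTime_pos hℓ h0 h1 (T.level G + 1)
    have h4 : 0 < ℓ * lam ^ T.level G := mul_pos hℓ (pow_pos h0 _)
    have h5 : ¬ t ≤ rightTime ℓ lam (T.level G) := by linarith
    have h6 : ¬ t ≤ gapTime ℓ lam (T.level G + 1) := by rw [rightTime] at h5; linarith
    rw [approx, if_neg h6, if_neg h5, ih, T.tgt_right]
    rw [T.level_right]
    linarith

/-- Apart from `2 ^ m` jumps of size at most `d * lam ^ (level + m)`, the approximation moves with
speed at most `1`. -/
lemma dist_approx_le (hℓ : 0 < ℓ) (hd : 0 ≤ d) (h0 : 0 < lam) (h1 : 2 * lam < 1) (m : ℕ) :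
    ∀ G s t, dist (T.approx m G s) (T.approx m G t) ≤
      |s - t| + 2 ^ m * (d * lam ^ (T.level G + m)) := by
  induction m with
  | zero =>
    intro G s t
    have h := T.dist_le G
    have h' := dist_comm (T.src G) (T.tgt G)
    have h2 : 0 ≤ d * lam ^ T.level G := mul_nonneg hd (pow_pos h0 _).le
    have h3 := abs_nonneg (s - t)
    simp only [approx, pow_zero, one_mul, add_zero]
    have h4 : dist (T.src G) (T.src G) = 0 := dist_self _
    have h5 : dist (T.tgt G) (T.tgt G) = 0 := dist_self _
    split_ifs <;> linarith
  | succ m ih =>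
    intro G s t
    set a := gapTime ℓ lam (T.level G + 1) with ha
    set b := rightTime ℓ lam (T.level G) with hb
    have hab : b = a + ℓ * lam ^ T.level G := rfl
    have hl : 0 < ℓ * lam ^ T.level G := mul_pos hℓ (pow_pos h0 _)
    have he : 0 ≤ 2 ^ m * (d * lam ^ (T.level G + 1 + m)) := by positivity
    have hL : ∀ s t, dist (T.approx m (T.left G) s) (T.approx m (T.left G) t) ≤
        |s - t| + 2 ^ m * (d * lam ^ (T.level G + 1 + m)) := by
      intro s t; simpa only [T.level_left] using ih (T.left G) s t
    have hR : ∀ s t, dist (T.approx m (T.right G) (s - b)) (T.approx m (T.right G) (t - b)) ≤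
        |s - t| + 2 ^ m * (d * lam ^ (T.level G + 1 + m)) := by
      intro s t
      simpa only [T.level_right, sub_sub_sub_cancel_right] using ih (T.right G) (s - b) (t - b)
    have hM : ∀ s t, dist (T.mid G (s - a)) (T.mid G (t - a)) ≤ |s - t| + 0 := by
      intro s t
      simpa only [sub_sub_sub_cancel_right] using
        lipschitzWith_one_iff.1 (T.lipschitz_mid G) (s - a) (t - a)
    have hMR := dist_ite_le (a := b) hM hR le_rfl he (by
      rw [sub_self, T.approx_of_nonpos hℓ h0 h1 le_rfl, hab, add_sub_cancel_left, T.mid_length])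
    have := dist_ite_le (a := a) hL hMR he (by linarith) (by
      rw [T.approx_of_ge hℓ h0 h1 _ _ _ (by rw [T.level_left]), if_pos (by linarith), sub_self,
        T.mid_zero]) s t
    refine this.trans_eq ?_
    rw [show T.level G + (m + 1) = T.level G + 1 + m by ring, pow_succ]
    ring

/-- Consecutive approximations differ only inside the gaps still open, so the bound is geometric in
`m` and the approximations are Cauchy. -/
lemma dist_approx_succ_le (hℓ : 0 < ℓ) (hd : 0 ≤ d) (h0 : 0 < lam) (h1 : 2 * lam < 1) (m : ℕ) :
    ∀ G t, dist (T.approx m G t) (T.approx (m + 1) G t) ≤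
      (ℓ / (1 - 2 * lam) + 2 * d) * lam ^ (T.level G + m) := by
  have hA : 0 < ℓ / (1 - 2 * lam) := div_pos hℓ (by linarith)
  induction m with
  | zero =>
    intro G t
    have hp : 0 < lam ^ T.level G := pow_pos h0 _
    have hK : 0 ≤ (ℓ / (1 - 2 * lam) + 2 * d) * lam ^ (T.level G + 0) := by positivity
    rcases le_total t 0 with ht | ht
    · rw [T.approx_of_nonpos hℓ h0 h1 ht, T.approx_of_nonpos hℓ h0 h1 ht, dist_self]
      exact hK
    rcases le_or_gt (gapTime ℓ lam (T.level G)) t with ht' | ht'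
    · rw [T.approx_of_ge hℓ h0 h1 _ _ _ ht', T.approx_of_ge hℓ h0 h1 _ _ _ ht', dist_self]
      exact hK
    -- Before `gapTime`, the generation `0` approximation still rests at the source, which is where
    -- generation `1` starts at time `0`.
    have h2 := T.dist_approx_le hℓ hd h0 h1 1 G 0 t
    rw [T.approx_of_nonpos hℓ h0 h1 le_rfl, zero_sub, abs_neg, abs_of_nonneg ht] at h2
    rw [approx, if_pos ht']
    rw [gapTime] at ht'
    have h3 : lam ^ (T.level G + 1) ≤ lam ^ T.level G :=
      pow_le_pow_of_le_one h0.le (by linarith) (Nat.le_succ _)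
    have h4 := mul_le_mul_of_nonneg_left h3 hd
    rw [add_zero, add_mul]
    linarith
  | succ m ih =>
    intro G t
    rw [show T.level G + (m + 1) = T.level G + 1 + m by ring]
    rw [approx.eq_2 T G t m, approx.eq_2 T G t (m + 1)]
    split_ifs
    · simpa only [T.level_left] using ih (T.left G) t
    · rw [dist_self]; positivity
    · simpa only [T.level_right] using ih (T.right G) (t - rightTime ℓ lam (T.level G))

/-- The total size of the jumps is a multiple of `(2 * lam) ^ m`, so the limit is `1`-Lipschitz. The
recursion for the approximations passes to the limit. -/
lemma exists_bridge [CompleteSpace Z] (hℓ : 0 < ℓ) (hd : 0 ≤ d) (h0 : 0 < lam)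
    (h1 : 2 * lam < 1) :
    ∃ f : N → ℝ → Z, ∀ G, LipschitzWith 1 (f G) ∧ f G 0 = T.src G ∧
      f G (gapTime ℓ lam (T.level G)) = T.tgt G ∧ ∀ t, f G t =
        if t ≤ gapTime ℓ lam (T.level G + 1) then f (T.left G) t
        else if t ≤ rightTime ℓ lam (T.level G) then T.mid G (t - gapTime ℓ lam (T.level G + 1))
        else f (T.right G) (t - rightTime ℓ lam (T.level G)) := by
  have hlim : ∀ G t, ∃ z, Tendsto (fun m ↦ T.approx m G t) atTop (𝓝 z) := by
    intro G t
    refine cauchySeq_tendsto_of_complete (cauchySeq_of_le_geometric lam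
      ((ℓ / (1 - 2 * lam) + 2 * d) * lam ^ T.level G) (by linarith) fun m ↦ ?_)
    rw [mul_assoc, ← pow_add]
    exact T.dist_approx_succ_le hℓ hd h0 h1 m G t
  choose f hf using hlim
  refine ⟨f, fun G ↦ ⟨?_, ?_, ?_, fun t ↦ ?_⟩⟩
  · rw [lipschitzWith_one_iff]
    intro s t
    refine le_of_tendsto_of_tendsto' ((hf G s).dist (hf G t)) ?_
      (T.dist_approx_le hℓ hd h0 h1 · G s t)
    have : Tendsto (fun m : ℕ ↦ |s - t| + (d * lam ^ T.level G) * (2 * lam) ^ m) atTop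
        (𝓝 (|s - t| + (d * lam ^ T.level G) * 0)) :=
      ((tendsto_pow_atTop_nhds_zero_of_lt_one (by linarith) h1).const_mul _).const_add _
    rw [mul_zero] at this
    refine this.congr fun m ↦ ?_
    rw [pow_add, mul_pow]
    ring
  · refine tendsto_nhds_unique (hf G 0) ?_
    simp only [T.approx_of_nonpos hℓ h0 h1 le_rfl, tendsto_const_nhds]
  · refine tendsto_nhds_unique (hf G _) ?_
    simp only [T.approx_of_ge hℓ h0 h1 _ _ _ le_rfl, tendsto_const_nhds]
  · refine tendsto_nhds_unique ((hf G t).comp (tendsto_add_atTop_nat 1)) ?_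
    simp only [Function.comp_def, approx]
    split_ifs
    · exact hf _ _
    · exact tendsto_const_nhds
    · exact hf _ _

/-- Off the residual set only middle parts of the first `m` generations are traversed, `2 ^ k` of
them in generation `k`. -/
lemma lintegral_diff_residual_le (h1 : 2 * lam < 1) {f : N → ℝ → Z}
    (hf : ∀ G t, f G t =
        if t ≤ gapTime ℓ lam (T.level G + 1) then f (T.left G) t
        else if t ≤ rightTime ℓ lam (T.level G) then T.mid G (t - gapTime ℓ lam (T.level G + 1))
        else f (T.right G) (t - rightTime ℓ lam (T.level G))) (m : ℕ) :
    ∀ G, ∫⁻ t in Icc 0 (gapTime ℓ lam (T.level G)) \ residual ℓ lam m (T.level G), ρ (f G t) ≤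
      ∑ k ∈ Finset.range m, 2 ^ k * c (T.level G + k) := by
  induction m with
  | zero => intro G; simp [residual]
  | succ m ih =>
    intro G
    set n := T.level G with hn
    set a := gapTime ℓ lam (n + 1) with ha
    set b := rightTime ℓ lam n with hb
    set C := residual ℓ lam m (n + 1) with hC
    have hCm : MeasurableSet C := measurableSet_residual m _
    have hab : b = a + ℓ * lam ^ n := rfl
    have hsub : Icc 0 (gapTime ℓ lam n) \ residual ℓ lam (m + 1) n ⊆
        ((Icc 0 a \ C) ∪ Ioc a b) ∪ ((fun t ↦ t - b) ⁻¹' (Icc 0 a \ C) ∩ Ioi b ∩ Ioi a) := by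
      rintro t ⟨⟨ht0, ht1⟩, ht2⟩
      rw [gapTime_eq h1 n] at ht1
      rw [residual, mem_union, not_or] at ht2
      rcases le_or_gt t a with h | h
      · exact Or.inl (Or.inl ⟨⟨ht0, h⟩, ht2.1⟩)
      rcases le_or_gt t b with h' | h'
      · exact Or.inl (Or.inr ⟨h, h'⟩)
      · refine Or.inr ⟨⟨⟨⟨by linarith, by linarith⟩, ht2.2⟩, h'⟩, h⟩
    have hmL : MeasurableSet (Icc 0 a \ C) := measurableSet_Icc.diff hCm
    have hmR : MeasurableSet ((fun t ↦ t - b) ⁻¹' (Icc 0 a \ C)) :=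
      (measurable_id.sub_const b) hmL
    have hL : ∫⁻ t in Icc 0 a \ C, ρ (f G t) ≤
        ∑ k ∈ Finset.range m, 2 ^ k * c (n + 1 + k) := by
      have := ih (T.left G)
      rw [T.level_left] at this
      refine le_trans (le_of_eq (setLIntegral_congr_fun hmL fun t ht ↦ ?_)) this
      rw [hf G t, if_pos ht.1.2]
    have hM : ∫⁻ t in Ioc a b, ρ (f G t) ≤ c n := by
      refine le_trans ?_ (T.lintegral_mid_le G)
      rw [← setLIntegral_Icc_comp_sub (fun t ↦ ρ (T.mid G t)) 0 _ a, zero_add, add_comm, ← hn,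
        ← hab]
      refine le_trans (le_of_eq (setLIntegral_congr_fun measurableSet_Ioc fun t ht ↦ ?_))
        (lintegral_mono_set Ioc_subset_Icc_self)
      rw [hf G t, if_neg (not_le.2 ht.1), if_pos ht.2]
    have hR : ∫⁻ t in (fun t ↦ t - b) ⁻¹' (Icc 0 a \ C) ∩ Ioi b ∩ Ioi a, ρ (f G t) ≤
        ∑ k ∈ Finset.range m, 2 ^ k * c (n + 1 + k) := by
      have := ih (T.right G)
      rw [T.level_right] at this
      refine le_trans ?_ this
      have h := (measurePreserving_sub_right volume b).setLIntegral_comp_preimage_emb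
        (MeasurableEquiv.subRight b).measurableEmbedding (fun t ↦ ρ (f (T.right G) t))
        (Icc 0 a \ C)
      rw [← h]
      refine le_trans (le_of_eq (setLIntegral_congr_fun
        ((hmR.inter measurableSet_Ioi).inter measurableSet_Ioi) fun t ht ↦ ?_))
        (lintegral_mono_set (inter_subset_left.trans inter_subset_left))
      rw [hf G t, if_neg (not_le.2 ht.2), if_neg (not_le.2 ht.1.2)]
    refine (lintegral_mono_set hsub).trans ((lintegral_union_le _ _ _).trans
      ((add_le_add ((lintegral_union_le _ _ _).trans (add_le_add hL hM)) hR).trans_eq ?_))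
    rw [Finset.sum_range_succ']
    simp only [pow_succ, add_assoc, add_comm 1, pow_zero, one_mul, add_zero]
    rw [add_left_comm, ← two_mul, Finset.mul_sum, add_comm]
    congr 1
    exact Finset.sum_congr rfl fun k _ ↦ by ring

/-- In a complete space the root gap of a tree of gaps can be bridged. -/
theorem joinedByCurve [CompleteSpace Z] (hℓ : 0 < ℓ) (hd : 0 ≤ d) (h0 : 0 < lam)
    (h1 : 2 * lam < 1) {B : ℝ≥0∞} (hB : ∀ m, ∑ k ∈ Finset.range m, 2 ^ k * c k ≤ B)
    {G : N} (hG : T.level G = 0) :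
    JoinedByCurve ρ (T.src G) (T.tgt G) (ℓ / (1 - 2 * lam)) B := by
  obtain ⟨f, hf⟩ := T.exists_bridge hℓ hd h0 h1
  obtain ⟨hfl, hf0, hf1, -⟩ := hf G
  have hlen : gapTime ℓ lam (T.level G) = ℓ / (1 - 2 * lam) := by simp [gapTime, hG]
  rw [hlen] at hf1
  refine ⟨f G, hfl, hf0, hf1, ?_⟩
  have hanti : Antitone fun m ↦ residual ℓ lam m 0 :=
    antitone_nat_of_succ_le fun m ↦ residual_succ_subset hℓ h0 h1 m 0
  -- The residual sets have length at most a constant times `(2 * lam) ^ m`. Thus the values of `ρ`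
  -- on what no middle part covers, even infinite ones, do not matter.
  have hnull : volume (⋂ m, residual ℓ lam m 0) = 0 := by
    refine le_antisymm (ge_of_tendsto' (x := atTop) (f := fun m : ℕ ↦
      ENNReal.ofReal (ℓ / (1 - 2 * lam) * (2 * lam) ^ m)) ?_ fun m ↦ ?_) zero_le
    · have := (tendsto_pow_atTop_nhds_zero_of_lt_one (by linarith) h1).const_mul
        (ℓ / (1 - 2 * lam))
      rw [mul_zero] at this
      simpa using ENNReal.tendsto_ofReal this
    · refine (measure_mono (iInter_subset _ m)).trans ((volume_residual_le m 0).trans_eq ?_)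
      rw [zero_add, gapTime, mul_pow, mul_left_comm,
        ENNReal.ofReal_mul (p := 2 ^ m) (by positivity),
        ENNReal.ofReal_pow (p := 2) (by norm_num), ENNReal.ofReal_ofNat]
  have hmono : Monotone fun m ↦ Icc 0 (ℓ / (1 - 2 * lam)) \ residual ℓ lam m 0 :=
    fun i j hij ↦ sdiff_subset_sdiff_right (hanti hij)
  have hIcc : (Icc 0 (ℓ / (1 - 2 * lam)) : Set ℝ) =ᵐ[volume]
      ⋃ m, Icc 0 (ℓ / (1 - 2 * lam)) \ residual ℓ lam m 0 := by
    rw [← sdiff_iInter]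
    exact (sdiff_null_ae_eq_self hnull).symm
  rw [setLIntegral_congr hIcc, setLIntegral_iUnion_of_directed _ hmono.directed_le]
  refine iSup_le fun m ↦ ?_
  have := T.lintegral_diff_residual_le h1 (fun G ↦ (hf G).2.2.2) m G
  rw [hlen, hG] at this
  simp only [zero_add] at this
  exact this.trans (hB m)

end GapTree

/-! ### Potentials and the choice of points where they are small. -/

section Potential

/-- Twice the `n`-th harmonic number. -/
def doubleHarmonic (n : ℕ) : ℝ := ∑ k ∈ Finset.range n, 2 / ((k : ℝ) + 1)

/-- Induction that removes whichever of the first and last index is farther from `τ`: it is at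
distance at least `n / 2`, and removing the first one shifts `τ` by `1`. -/
lemma sum_inv_one_add_abs_le (n : ℕ) : ∀ τ : ℝ,
    ∑ i ∈ Finset.range n, 1 / (1 + |(i : ℝ) - τ|) ≤ doubleHarmonic n := by
  induction n with
  | zero => intro τ; simp [doubleHarmonic]
  | succ n ih =>
    intro τ
    have hn : (0 : ℝ) ≤ n := n.cast_nonneg
    have key : ∀ u : ℝ, (n : ℝ) / 2 ≤ u → 1 / (1 + u) ≤ 2 / ((n : ℝ) + 1) := by
      intro u hu
      rw [div_le_div_iff₀ (by linarith) (by linarith)]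
      linarith
    have hsucc : doubleHarmonic (n + 1) = doubleHarmonic n + 2 / ((n : ℝ) + 1) :=
      Finset.sum_range_succ _ n
    rw [hsucc]
    rcases le_total τ (n / 2) with h | h
    · rw [Finset.sum_range_succ]
      exact add_le_add (ih τ) (key _ (le_trans (by linarith) (le_abs_self _)))
    · rw [Finset.sum_range_succ']
      refine add_le_add ?_ (key _ ?_)
      · refine le_trans (le_of_eq (Finset.sum_congr rfl fun i _ ↦ ?_)) (ih (τ - 1))
        push_cast
        rw [sub_sub_eq_add_sub, add_sub_right_comm]
      · exact le_trans (by simpa using h) (neg_le_abs _)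

lemma tendsto_doubleHarmonic_div :
    Tendsto (fun n : ℕ ↦ doubleHarmonic n / n) atTop (𝓝 0) := by
  have h : Tendsto (fun k : ℕ ↦ 2 / ((k : ℝ) + 1)) atTop (𝓝 0) := by
    simpa [div_eq_mul_inv] using (tendsto_one_div_add_atTop_nhds_zero_nat (𝕜 := ℝ)).const_mul 2
  refine h.cesaro.congr fun n ↦ ?_
  rw [doubleHarmonic, div_eq_inv_mul]

lemma two_le_doubleHarmonic {n : ℕ} (hn : 0 < n) : 2 ≤ doubleHarmonic n := by
  have h := Finset.single_le_sum (f := fun k : ℕ ↦ 2 / ((k : ℝ) + 1)) (s := Finset.range n)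
    (fun k _ ↦ by positivity) (Finset.mem_range.2 hn)
  simpa [doubleHarmonic] using h

/-- The kernel `R / (R + d(z, w))`. -/
def kernel (R : ℝ) (z w : Z) : ℝ := R / (R + dist z w)

lemma sum_kernel_le {n : ℕ} (hn : 0 < n) {R : ℝ} (hR : 0 < R) {z : Z} {x : ℕ → Z} {a : ℝ}
    (ha : a ≤ 3 * R) (hx : ∀ i < n, dist (x i) z = a + i * (R / n)) (w : Z) :
    ∑ i ∈ Finset.range n, kernel (R / n) (x i) w ≤ 9 * doubleHarmonic n * kernel R z w := by
  have hn' : (0 : ℝ) < n := Nat.cast_pos.2 hn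
  have hH := two_le_doubleHarmonic hn
  have hRn : 0 < R / n := div_pos hR hn'
  have hD : 0 ≤ dist z w := dist_nonneg
  have hk : 0 < kernel R z w := div_pos hR (by linarith)
  -- If `w` is near `z`, the kernel at scale `R` is at least `1 / 9` and the sum is harmonic by the
  -- reverse triangle inequality. If `w` is far away, every `x i` has distance at least `dist z w /
  -- 2` from it, and no logarithm occurs.
  rcases le_or_gt (dist z w) (8 * R) with h | h
  · have h1 : 1 / 9 ≤ kernel R z w := by
      rw [kernel, div_le_div_iff₀ (by norm_num) (by linarith)]
      linarith
    calc ∑ i ∈ Finset.range n, kernel (R / n) (x i) w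
        ≤ ∑ i ∈ Finset.range n, 1 / (1 + |(i : ℝ) - (dist z w - a) / (R / n)|) := by
          refine Finset.sum_le_sum fun i hi ↦ ?_
          have h2 : |dist (x i) z - dist w z| ≤ dist (x i) w := abs_dist_sub_le _ _ _
          rw [hx i (Finset.mem_range.1 hi), dist_comm w z] at h2
          have h3 : a + i * (R / n) - dist z w =
              (R / n) * ((i : ℝ) - (dist z w - a) / (R / n)) := by
            rw [mul_sub, mul_div_cancel₀ _ hRn.ne']
            ring
          rw [h3, abs_mul, abs_of_pos hRn] at h2
          rw [kernel, div_le_div_iff₀ (by linarith [dist_nonneg (x := x i) (y := w)])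
            (by positivity)]
          linarith
      _ ≤ doubleHarmonic n := sum_inv_one_add_abs_le n _
      _ ≤ 9 * doubleHarmonic n * kernel R z w := by
          nlinarith [mul_le_mul_of_nonneg_left h1 (by linarith : 0 ≤ doubleHarmonic n)]
  · have hDpos : 0 < dist z w := by linarith
    calc ∑ i ∈ Finset.range n, kernel (R / n) (x i) w
        ≤ ∑ _i ∈ Finset.range n, (R / n) / (dist z w / 2) := by
          refine Finset.sum_le_sum fun i hi ↦ ?_
          have hi' : (i : ℝ) ≤ n := Nat.cast_le.2 (Finset.mem_range.1 hi).le
          have h2 : dist (x i) z ≤ 4 * R := by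
            rw [hx i (Finset.mem_range.1 hi)]
            have : (i : ℝ) * (R / n) ≤ n * (R / n) := mul_le_mul_of_nonneg_right hi' hRn.le
            rw [mul_div_cancel₀ _ hn'.ne'] at this
            linarith
          have h3 := dist_triangle_left z w (x i)
          rw [kernel]
          exact div_le_div_of_nonneg_left hRn.le (by linarith) (by linarith)
      _ = 2 * R / dist z w := by
          rw [Finset.sum_const, Finset.card_range, nsmul_eq_mul]
          field_simp
      _ ≤ 4 * kernel R z w := by
          rw [kernel, mul_div_assoc', div_le_div_iff₀ hDpos (by linarith)]
          nlinarith
      _ ≤ 9 * doubleHarmonic n * kernel R z w :=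
          mul_le_mul_of_nonneg_right (by linarith) hk.le

variable [MeasurableSpace Z]

/-- The potential of a measure with respect to the kernel `R / (R + d(z, w))`. -/
def potential (ν : Measure Z) (z : Z) (R : ℝ) : ℝ≥0∞ := ∫⁻ w, ENNReal.ofReal (kernel R z w) ∂ν

lemma potential_le_measure_univ (ν : Measure Z) (z : Z) {R : ℝ} (hR : 0 < R) :
    potential ν z R ≤ ν univ := by
  refine (lintegral_mono (g := fun _ ↦ 1) fun w ↦ ?_).trans_eq (by simp)
  rw [← ENNReal.ofReal_one]
  refine ENNReal.ofReal_le_ofReal ?_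
  rw [kernel, div_le_one (by positivity)]
  linarith [dist_nonneg (x := z) (y := w)]

variable [BorelSpace Z]

lemma measurable_kernel (R : ℝ) (z : Z) :
    Measurable fun w ↦ ENNReal.ofReal (kernel R z w) := by
  unfold kernel
  exact (((continuous_const.dist continuous_id).measurable.const_add R).const_div R).ennreal_ofReal

lemma measure_ball_le_potential (ν : Measure Z) (z : Z) {R K : ℝ} (hR : 0 < R) (hK : 0 ≤ K) :
    ν (Metric.ball z (K * R)) ≤ ENNReal.ofReal (1 + K) * potential ν z R := by
  rw [potential, ← lintegral_const_mul _ (measurable_kernel R z), ← lintegral_indicator_one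
    Metric.isOpen_ball.measurableSet]
  refine lintegral_mono (indicator_le fun w hw ↦ ?_)
  rw [← ENNReal.ofReal_mul (by linarith), Pi.one_apply, ← ENNReal.ofReal_one]
  refine ENNReal.ofReal_le_ofReal ?_
  rw [Metric.mem_ball, dist_comm] at hw
  rw [kernel, mul_div_assoc', one_le_div (by positivity)]
  linarith

/-- A connected set that crosses an annulus around `z` contains a point at which the potential at
the scale `R / n` is much smaller than the potential at `z` at scale `R`. -/
lemma exists_potential_le (ν : Measure Z) {n : ℕ} (hn : 0 < n) {R : ℝ} (hR : 0 < R) {A : Set Z}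
    (hA : IsPreconnected A) {z p q : Z} (hp : p ∈ A) (hq : q ∈ A) (hpz : dist p z ≤ R)
    (hqz : 4 * R ≤ dist q z) {a : ℝ} (ha : R ≤ a) (ha' : a ≤ 3 * R) :
    ∃ x ∈ A, a ≤ dist x z ∧ dist x z ≤ a + R ∧
      potential ν x (R / n) ≤ ENNReal.ofReal (9 * doubleHarmonic n / n) * potential ν z R := by
  have hn' : (0 : ℝ) < n := Nat.cast_pos.2 hn
  have hmem : ∀ i < n, a ≤ a + i * (R / n) ∧ a + i * (R / n) ≤ a + R := by
    intro i hi
    refine ⟨by have : 0 ≤ i * (R / n) := by positivity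
               linarith, ?_⟩
    have : (i : ℝ) * (R / n) ≤ n * (R / n) :=
      mul_le_mul_of_nonneg_right (Nat.cast_le.2 hi.le) (by positivity)
    rw [mul_div_cancel₀ _ hn'.ne'] at this
    linarith
  have hex : ∀ i, ∃ x, i < n → x ∈ A ∧ dist x z = a + i * (R / n) := by
    intro i
    by_cases hi : i < n
    · obtain ⟨x, hx, hxz⟩ := hA.intermediate_value hp hq
        (continuous_id.dist continuous_const).continuousOn (f := fun x ↦ dist x z)
        (show a + i * (R / n) ∈ Icc (dist p z) (dist q z) from
          ⟨by linarith [(hmem i hi).1], by linarith [(hmem i hi).2]⟩)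
      exact ⟨x, fun _ ↦ ⟨hx, hxz⟩⟩
    · exact ⟨z, fun h ↦ absurd h hi⟩
  choose x hx using hex
  have hH := two_le_doubleHarmonic hn
  have hsum : ∑ i ∈ Finset.range n, potential ν (x i) (R / n) ≤
      ∑ _i ∈ Finset.range n, ENNReal.ofReal (9 * doubleHarmonic n / n) * potential ν z R := by
    rw [Finset.sum_const, Finset.card_range, nsmul_eq_mul, ← mul_assoc, ← ENNReal.ofReal_natCast,
      ← ENNReal.ofReal_mul hn'.le, mul_div_cancel₀ _ hn'.ne']
    unfold potential
    rw [← lintegral_finsetSum _ fun i _ ↦ measurable_kernel _ _,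
      ← lintegral_const_mul _ (measurable_kernel R z)]
    refine lintegral_mono fun w ↦ ?_
    rw [← ENNReal.ofReal_sum_of_nonneg, ← ENNReal.ofReal_mul (by linarith)]
    · exact ENNReal.ofReal_le_ofReal (sum_kernel_le hn hR ha'
        (fun i hi ↦ (hx i hi).2) w)
    · intro i _
      unfold kernel
      positivity
  -- Pigeonhole: if every point violated the bound, so would the sum.
  by_contra! hcon
  refine absurd hsum (not_le.2 (ENNReal.sum_lt_sum_of_nonempty
    (Finset.nonempty_range_iff.2 hn.ne') fun i hi ↦ ?_))
  have hi' := Finset.mem_range.1 hi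
  obtain ⟨h1, h2⟩ := hx i hi'
  exact hcon (x i) h1 (h2 ▸ (hmem i hi').1) (h2 ▸ (hmem i hi').2)

end Potential

/-! ### Logarithmic test densities for curves crossing a thick annulus. -/

section LogDensity

/-- Dyadic radii `8 * 2 ^ j * R`. -/
def dyadicRadius (R : ℝ) (j : ℕ) : ℝ := 8 * 2 ^ j * R

lemma dyadicRadius_pos {R : ℝ} (hR : 0 < R) (j : ℕ) : 0 < dyadicRadius R j := by
  unfold dyadicRadius; positivity

lemma dyadicRadius_succ (R : ℝ) (j : ℕ) : dyadicRadius R (j + 1) = 2 * dyadicRadius R j := by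
  rw [dyadicRadius, dyadicRadius, pow_succ]; ring

lemma monotone_dyadicRadius {R : ℝ} (hR : 0 < R) : Monotone (dyadicRadius R) :=
  monotone_nat_of_le_succ fun j ↦ by linarith [dyadicRadius_succ R j, dyadicRadius_pos hR j]

/-- The radial profile of a density that approximates `1 / (N * s)` on `[8 * R, 8 * 2 ^ N * R]`. -/
def logProfile (R : ℝ) (N : ℕ) (s : ℝ) : ℝ≥0∞ :=
  ∑ j ∈ Finset.range N, (Ico (dyadicRadius R j) (dyadicRadius R (j + 1))).indicator
    (fun _ ↦ ENNReal.ofReal (1 / (N * dyadicRadius R j))) s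

lemma measurable_logProfile (R : ℝ) (N : ℕ) : Measurable (logProfile R N) :=
  Finset.measurable_sum _ fun _ _ ↦ measurable_const.indicator measurableSet_Ico

lemma setLIntegral_logProfile {R : ℝ} (hR : 0 < R) {N : ℕ} (hN : 0 < N) :
    ∫⁻ s in Ico (dyadicRadius R 0) (dyadicRadius R N), logProfile R N s = 1 := by
  have hN' : (0 : ℝ) < N := Nat.cast_pos.2 hN
  unfold logProfile
  rw [lintegral_finsetSum _ fun j _ ↦ measurable_const.indicator measurableSet_Ico]
  have key : ∀ j ∈ Finset.range N, ∫⁻ s in Ico (dyadicRadius R 0) (dyadicRadius R N),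
      (Ico (dyadicRadius R j) (dyadicRadius R (j + 1))).indicator
        (fun _ ↦ ENNReal.ofReal (1 / (N * dyadicRadius R j))) s = ENNReal.ofReal (1 / N) := by
    intro j hj
    have hp := dyadicRadius_pos hR j
    rw [lintegral_indicator measurableSet_Ico, Measure.restrict_restrict measurableSet_Ico,
      inter_eq_left.2 (Ico_subset_Ico (monotone_dyadicRadius hR (Nat.zero_le j))
        (monotone_dyadicRadius hR (Finset.mem_range.1 hj))), setLIntegral_const, Real.volume_Ico,
      dyadicRadius_succ, ← ENNReal.ofReal_mul (by positivity)]
    congr 1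
    field_simp
    ring
  rw [Finset.sum_congr rfl key, Finset.sum_const, Finset.card_range, nsmul_eq_mul,
    ← ENNReal.ofReal_natCast, ← ENNReal.ofReal_mul hN'.le, mul_one_div_cancel hN'.ne',
    ENNReal.ofReal_one]

/-- The bands are disjoint, so the power acts on a single summand; enlarging bands to half-lines
produces balls, to which the upper mass bound applies. -/
lemma logProfile_rpow_le {R : ℝ} (hR : 0 < R) (N : ℕ) {Q : ℝ} (hQ : 0 < Q) (s : ℝ) :
    logProfile R N s ^ Q ≤ ∑ j ∈ Finset.range N, (Iio (dyadicRadius R (j + 1))).indicator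
      (fun _ ↦ ENNReal.ofReal (1 / (N * dyadicRadius R j)) ^ Q) s := by
  by_cases h : ∃ k ∈ Finset.range N, s ∈ Ico (dyadicRadius R k) (dyadicRadius R (k + 1))
  · obtain ⟨k, hk, hs⟩ := h
    have h1 : logProfile R N s = ENNReal.ofReal (1 / (N * dyadicRadius R k)) := by
      rw [logProfile, Finset.sum_eq_single_of_mem k hk, indicator_of_mem hs]
      intro j _ hjk
      refine indicator_of_notMem (fun hj ↦ ?_) _
      exact disjoint_left.1 ((monotone_dyadicRadius hR).pairwise_disjoint_on_Ico_succ hjk) hj hs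
    rw [h1]
    refine le_trans (le_of_eq ?_) (Finset.single_le_sum (fun _ _ ↦ zero_le) hk)
    rw [indicator_of_mem (by exact hs.2)]
  · push Not at h
    have h1 : logProfile R N s = 0 :=
      Finset.sum_eq_zero fun j hj ↦ indicator_of_notMem (h j hj) _
    rw [h1, ENNReal.zero_rpow_of_pos hQ]
    exact zero_le

variable [MeasurableSpace Z] [BorelSpace Z]

/-- Curves that start in `B(z, 8 * R)` and leave a much larger ball have small modulus. -/
lemma exists_log_density {μ : Measure Z} {Q C : ℝ} (hQ : 1 < Q) (hC : 0 < C)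
    (hup : ∀ (a : Z) (R : ℝ), 0 < R → ENNReal.ofReal R ≤ Metric.ediam (univ : Set Z) →
      μ (Metric.ball a R) ≤ ENNReal.ofReal (C * R ^ Q)) {ε : ℝ} (hε : 0 < ε) :
    ∃ K : ℝ, 8 ≤ K ∧ ∀ (z : Z) (R : ℝ), 0 < R →
      ENNReal.ofReal (K * R) ≤ Metric.ediam (univ : Set Z) →
      ∃ w : Z → ℝ≥0∞, Measurable w ∧ ∫⁻ v, w v ^ Q ∂μ ≤ ENNReal.ofReal ε ∧
        ∀ (f : ℝ → Z) (ℓ : ℝ), LipschitzWith 1 f → f 0 ∈ Metric.ball z (8 * R) →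
          (∃ t ∈ Icc 0 ℓ, f t ∉ Metric.ball z (K * R)) → 1 ≤ ∫⁻ t in Icc 0 ℓ, w (f t) := by
  -- Each of the `N` dyadic bands has energy at most `C * 2 ^ Q * N ^ (-Q)`; the total tends to `0`
  -- because `Q > 1`.
  have hlim : Tendsto (fun N : ℕ ↦ C * 2 ^ Q * (N : ℝ) ^ (-(Q - 1))) atTop (𝓝 (C * 2 ^ Q * 0)) :=
    ((tendsto_rpow_neg_atTop (by linarith : 0 < Q - 1)).comp
      tendsto_natCast_atTop_atTop).const_mul _
  rw [mul_zero] at hlim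
  obtain ⟨N, hNε, hN⟩ := ((hlim.eventually_le_const hε).and (eventually_gt_atTop 0)).exists
  have hN' : (0 : ℝ) < N := Nat.cast_pos.2 hN
  refine ⟨8 * 2 ^ N, ?_, fun z R hR hRd ↦ ?_⟩
  · have : (1 : ℝ) ≤ 2 ^ N := one_le_pow₀ (by norm_num)
    linarith
  have hdist : Measurable fun v : Z ↦ dist v z := (continuous_id.dist continuous_const).measurable
  refine ⟨fun v ↦ logProfile R N (dist v z), (measurable_logProfile R N).comp hdist, ?_, ?_⟩
  · calc ∫⁻ v, logProfile R N (dist v z) ^ Q ∂μ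
        ≤ ∫⁻ v, ∑ j ∈ Finset.range N, (Metric.ball z (dyadicRadius R (j + 1))).indicator
            (fun _ ↦ ENNReal.ofReal (1 / (N * dyadicRadius R j)) ^ Q) v ∂μ :=
          lintegral_mono fun v ↦ logProfile_rpow_le hR N (by linarith) (dist v z)
      _ = ∑ j ∈ Finset.range N, ENNReal.ofReal (1 / (N * dyadicRadius R j)) ^ Q *
            μ (Metric.ball z (dyadicRadius R (j + 1))) := by
          rw [lintegral_finsetSum _ fun j _ ↦
            measurable_const.indicator Metric.isOpen_ball.measurableSet]
          refine Finset.sum_congr rfl fun j _ ↦ ?_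
          rw [lintegral_indicator Metric.isOpen_ball.measurableSet, setLIntegral_const]
      _ ≤ ∑ _j ∈ Finset.range N, ENNReal.ofReal (C * 2 ^ Q * (N : ℝ) ^ (-Q)) := by
          refine Finset.sum_le_sum fun j hj ↦ ?_
          have hp := dyadicRadius_pos hR j
          have hle : dyadicRadius R (j + 1) ≤ 8 * 2 ^ N * R :=
            monotone_dyadicRadius hR (Finset.mem_range.1 hj)
          refine (mul_le_mul_right (hup z _ (dyadicRadius_pos hR _)
            ((ENNReal.ofReal_le_ofReal hle).trans hRd)) _).trans_eq ?_
          rw [ENNReal.ofReal_rpow_of_nonneg (by positivity) (by linarith),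
            ← ENNReal.ofReal_mul (by positivity), dyadicRadius_succ,
            Real.mul_rpow (by norm_num) hp.le, one_div, Real.inv_rpow (by positivity),
            Real.mul_rpow hN'.le hp.le, Real.rpow_neg hN'.le]
          congr 1
          have h1 : (dyadicRadius R j) ^ Q ≠ 0 := (Real.rpow_pos_of_pos hp _).ne'
          have h2 : (N : ℝ) ^ Q ≠ 0 := (Real.rpow_pos_of_pos hN' _).ne'
          field_simp
      _ = ENNReal.ofReal (C * 2 ^ Q * (N : ℝ) ^ (-(Q - 1))) := by
          rw [Finset.sum_const, Finset.card_range, nsmul_eq_mul, ← ENNReal.ofReal_natCast,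
            ← ENNReal.ofReal_mul hN'.le, neg_sub, sub_eq_add_neg, Real.rpow_add hN',
            Real.rpow_one]
          congr 1
          ring
      _ ≤ ENNReal.ofReal ε := ENNReal.ofReal_le_ofReal hNε
  · rintro f ℓ hf h0 ⟨t, ht, hft⟩
    have hg : LipschitzWith 1 fun t ↦ dist (f t) z := by
      have := (LipschitzWith.dist_left z).comp hf
      rwa [one_mul] at this
    rw [← setLIntegral_logProfile hR hN]
    refine setLIntegral_le_setLIntegral_comp hg (fun s hs ↦ ?_) (measurable_logProfile R N)
    have h1 : s ∈ Icc (dist (f 0) z) (dist (f t) z) := by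
      rw [Metric.mem_ball] at h0 hft
      refine ⟨?_, hs.2.le.trans (not_lt.1 hft)⟩
      have : dyadicRadius R 0 = 8 * R := by simp [dyadicRadius]
      linarith [hs.1]
    obtain ⟨τ, hτ, rfl⟩ := intermediate_value_Icc ht.1 hg.continuous.continuousOn h1
    exact ⟨τ, ⟨hτ.1, hτ.2.trans ht.2⟩, rfl⟩

end LogDensity

/-! ### Using the hypothesis on balls. -/

section BallCondition

/-- The Loewner condition for pairs of disjoint balls with positive relative distance. -/
def BallLoewner [MeasurableSpace Z] (Q : ℝ) (μ : Measure Z) (Ψ : ℝ → ℝ) : Prop :=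
  ∀ (a b : Z) (r s : ℝ), 0 < r → 0 < s → Disjoint (Metric.ball a r) (Metric.ball b s) →
    0 < relDist (Metric.ball a r) (Metric.ball b s) →
    ENNReal.ofReal (Ψ (relDist (Metric.ball a r) (Metric.ball b s))) ≤
      modulus Q μ (connectingPaths (Metric.ball a r) (Metric.ball b s))

lemma setDist_le {E F : Set Z} {x y : Z} (hx : x ∈ E) (hy : y ∈ F) : setDist E F ≤ edist x y :=
  (iInf₂_le x hx).trans (iInf₂_le y hy)

lemma ofReal_le_setDist_ball {x y : Z} {s : ℝ} (h : 3 * s ≤ dist x y) :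
    ENNReal.ofReal s ≤ setDist (Metric.ball x s) (Metric.ball y s) := by
  refine le_iInf₂ fun u hu ↦ le_iInf₂ fun v hv ↦ ?_
  rw [edist_dist]
  refine ENNReal.ofReal_le_ofReal ?_
  rw [Metric.mem_ball] at hu hv
  have h1 := dist_triangle4 x u v y
  rw [dist_comm x u] at h1
  linarith

/-- The diameter of a ball may be much smaller than its radius. The points `x'` and `y'` bound it
below by `s'`, which bounds the relative distance above by `T`. -/
lemma BallLoewner.le_modulus [MeasurableSpace Z] {Q : ℝ} {μ : Measure Z} {Ψ : ℝ → ℝ}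
    (hb : BallLoewner Q μ Ψ) (hΨ : IsLoewnerFunction Ψ) {x y x' y' : Z} {s s' T : ℝ} (hs' : 0 < s')
    (hs : s' < s) (hx : dist x' x = s') (hy : dist y' y = s') (h3 : 3 * s ≤ dist x y)
    (hT : dist x y ≤ T * s') :
    ENNReal.ofReal (Ψ T) ≤
      modulus Q μ (connectingPaths (Metric.ball x s) (Metric.ball y s)) := by
  have hs0 : 0 < s := hs'.trans hs
  set m := min (Metric.ediam (Metric.ball x s)) (Metric.ediam (Metric.ball y s)) with hm
  have hdiam : ∀ {u u' : Z}, dist u' u = s' →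
      ENNReal.ofReal s' ≤ Metric.ediam (Metric.ball u s) := by
    intro u u' hu
    rw [← hu, ← edist_dist]
    exact Metric.edist_le_ediam_of_mem (by rw [Metric.mem_ball, hu]; exact hs)
      (Metric.mem_ball_self hs0)
  have hm1 : ENNReal.ofReal s' ≤ m := le_min (hdiam hx) (hdiam hy)
  have hm2 : m ≠ ∞ := ne_top_of_le_ne_top Metric.isBounded_ball.ediam_ne_top (min_le_left _ _)
  have hm0 : m ≠ 0 := ((ENNReal.ofReal_pos.2 hs').trans_le hm1).ne'
  have hd1 := ofReal_le_setDist_ball h3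
  have hd2 : setDist (Metric.ball x s) (Metric.ball y s) ≤ ENNReal.ofReal (T * s') :=
    (setDist_le (Metric.mem_ball_self hs0) (Metric.mem_ball_self hs0)).trans
      (by rw [edist_dist]; exact ENNReal.ofReal_le_ofReal hT)
  have hd0 : setDist (Metric.ball x s) (Metric.ball y s) ≠ 0 :=
    ((ENNReal.ofReal_pos.2 hs0).trans_le hd1).ne'
  have hdt : setDist (Metric.ball x s) (Metric.ball y s) ≠ ∞ :=
    ne_top_of_le_ne_top ENNReal.ofReal_ne_top hd2
  have hpos : 0 < relDist (Metric.ball x s) (Metric.ball y s) :=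
    ENNReal.toReal_pos (ENNReal.div_pos hd0 hm2).ne' (ENNReal.div_ne_top hdt hm0)
  have hT0 : 0 < T := by
    have : 0 < T * s' := by linarith
    exact pos_of_mul_pos_left this hs'.le
  have hle : relDist (Metric.ball x s) (Metric.ball y s) ≤ T := by
    refine ENNReal.toReal_le_of_le_ofReal hT0.le ?_
    refine (ENNReal.div_le_div hd2 hm1).trans_eq ?_
    rw [← ENNReal.ofReal_div_of_pos hs', mul_div_cancel_right₀ _ hs'.ne']
  refine le_trans (ENNReal.ofReal_le_ofReal (hΨ.2 hpos hT0 hle)) (hb x y s s hs0 hs0 ?_ hpos)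
  exact Metric.ball_disjoint_ball (by linarith)

lemma exists_dist_eq_of_isPreconnected {A : Set Z} (hA : IsPreconnected A) {x q : Z} (hx : x ∈ A)
    (hq : q ∈ A) {s : ℝ} (hs : 0 ≤ s) (hsq : s ≤ dist q x) : ∃ x' ∈ A, dist x' x = s := by
  obtain ⟨x', hx', h⟩ := hA.intermediate_value hx hq
    (continuous_id.dist continuous_const).continuousOn (f := fun v ↦ dist v x)
    (show s ∈ Icc (dist x x) (dist q x) by simp [hs, hsq])
  exact ⟨x', hx', h⟩

end BallCondition

/-! ### Cheap short paths in a family of large modulus. -/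

section Step

lemma modulus_le [MeasurableSpace Z] {Q : ℝ} {μ : Measure Z} {Γ : Set C(I, Z)} {ρ : Z → ℝ≥0∞}
    (h : IsAdmissible Γ ρ) : modulus Q μ Γ ≤ ∫⁻ z, ρ z ^ Q ∂μ := iInf₂_le ρ h

lemma sup_rpow_le_add {a b : ℝ≥0∞} {Q : ℝ} : (a ⊔ b) ^ Q ≤ a ^ Q + b ^ Q := by
  rcases le_total a b with h | h
  · rw [sup_eq_right.2 h]; exact le_add_self
  · rw [sup_eq_left.2 h]; exact le_self_add

variable [MeasurableSpace Z] [BorelSpace Z]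

/-- A family of paths with large modulus that start close to `z` contains a path that is neither
long nor has large integral of `ρ`. -/
lemma exists_short_path {μ : Measure Z} {Q C : ℝ} (hQ : 1 < Q) (hC : 0 < C)
    (hup : ∀ (a : Z) (R : ℝ), 0 < R → ENNReal.ofReal R ≤ Metric.ediam (univ : Set Z) →
      μ (Metric.ball a R) ≤ ENNReal.ofReal (C * R ^ Q)) {m : ℝ} (hm : 0 < m) :
    ∃ K L c : ℝ, 0 < K ∧ 0 < L ∧ 0 < c ∧ ∀ (z : Z) (R φ : ℝ), 0 < R → 0 < φ →
      ENNReal.ofReal (K * R) ≤ Metric.ediam (univ : Set Z) →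
      ∀ ρ : Z → ℝ≥0∞, Measurable ρ →
      potential (μ.withDensity fun v ↦ ρ v ^ Q) z R ≤ ENNReal.ofReal φ →
      ∀ Γ : Set C(I, Z), (∀ γ ∈ Γ, γ 0 ∈ Metric.ball z (8 * R)) →
      ENNReal.ofReal m ≤ modulus Q μ Γ →
      ∃ γ ∈ Γ, IsRectifiable γ ∧ (pathLength γ).toReal ≤ L * R ∧
        lineIntegral ρ γ ≤ ENNReal.ofReal (c * φ ^ (1 / Q)) := by
  have hQ0 : 0 < Q := by linarith
  obtain ⟨K, hK, hlog⟩ := exists_log_density hQ hC hup (ε := m / 4) (by linarith)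
  have hK0 : 0 < K := by linarith
  -- The constants `c` and `L` make the energies of `h₁` and `h₂` below at most `m / 4`.
  set c : ℝ := (4 * (1 + K) / m) ^ (1 / Q) with hc
  set L : ℝ := K * (4 * C / m) ^ (1 / Q) with hL
  have hc0 : 0 < c := Real.rpow_pos_of_pos (by positivity) _
  have hL0 : 0 < L := mul_pos hK0 (Real.rpow_pos_of_pos (by positivity) _)
  have hcQ : c ^ Q = 4 * (1 + K) / m := by
    rw [hc, one_div, Real.rpow_inv_rpow (by positivity) hQ0.ne']
  have hLQ : L ^ Q = K ^ Q * (4 * C / m) := by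
    rw [hL, Real.mul_rpow hK0.le (by positivity), one_div,
      Real.rpow_inv_rpow (by positivity) hQ0.ne']
  refine ⟨K, L, c, hK0, hL0, hc0, fun z R φ hR hφ hRd ρ hρ hpot Γ hΓ hmod ↦ ?_⟩
  obtain ⟨w, hwm, hwQ, hw⟩ := hlog z R hR hRd
  by_contra! hcon
  set U := Metric.ball z (K * R) with hU
  have hUm : MeasurableSet U := Metric.isOpen_ball.measurableSet
  set b : ℝ := c * φ ^ (1 / Q) with hb
  have hb0 : 0 < b := mul_pos hc0 (Real.rpow_pos_of_pos hφ _)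
  have hbQ : b ^ Q = 4 * (1 + K) / m * φ := by
    rw [hb, Real.mul_rpow hc0.le (Real.rpow_pos_of_pos hφ _).le, hcQ, one_div,
      Real.rpow_inv_rpow hφ.le hQ0.ne']
  set h₁ : Z → ℝ≥0∞ := U.indicator fun v ↦ ENNReal.ofReal b⁻¹ * ρ v with hh₁
  set h₂ : Z → ℝ≥0∞ := U.indicator fun _ ↦ ENNReal.ofReal (L * R)⁻¹ with hh₂
  have hm₁ : Measurable h₁ := (hρ.const_mul _).indicator hUm
  have hm₂ : Measurable h₂ := measurable_const.indicator hUm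
  -- If the claim fails, each rectifiable path of `Γ` leaves `U`, or is short with large
  -- `ρ`-integral, or is long inside `U`. The densities `w`, `h₁`, `h₂` handle these cases, with
  -- total energy at most `3 * m / 4 < m`.
  have hadm : IsAdmissible Γ fun v ↦ w v ⊔ (h₁ v ⊔ h₂ v) := by
    refine ⟨hwm.sup (hm₁.sup hm₂), fun γ hγ hγr ↦ ?_⟩
    rw [lineIntegral_eq_arclengthCurve]
    set ℓ := (pathLength γ).toReal with hℓ
    by_cases hout : ∃ t ∈ Icc 0 ℓ, arclengthCurve γ t ∉ U
    · refine (hw _ ℓ hγr.lipschitzWith_arclengthCurve ?_ hout).trans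
        (lintegral_mono fun t ↦ le_sup_left)
      rw [hγr.arclengthCurve_zero]
      exact hΓ γ hγ
    push Not at hout
    by_cases hlen : ℓ ≤ L * R
    · have h := hcon γ hγ hγr hlen
      calc (1 : ℝ≥0∞) = ENNReal.ofReal b⁻¹ * ENNReal.ofReal b := by
            rw [← ENNReal.ofReal_mul (by positivity), inv_mul_cancel₀ hb0.ne', ENNReal.ofReal_one]
        _ ≤ ENNReal.ofReal b⁻¹ * lineIntegral ρ γ := mul_le_mul_right h.le _
        _ = ∫⁻ t in Icc 0 ℓ, ENNReal.ofReal b⁻¹ * ρ (arclengthCurve γ t) := by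
            rw [lineIntegral_eq_arclengthCurve]
            exact (lintegral_const_mul _
              (hρ.comp hγr.lipschitzWith_arclengthCurve.continuous.measurable)).symm
        _ = ∫⁻ t in Icc 0 ℓ, h₁ (arclengthCurve γ t) := by
            refine setLIntegral_congr_fun measurableSet_Icc fun t ht ↦ ?_
            simp only [hh₁, indicator_of_mem (hout t ht)]
        _ ≤ _ := lintegral_mono fun t ↦ le_sup_left.trans le_sup_right
    · push Not at hlen
      calc (1 : ℝ≥0∞) ≤ ENNReal.ofReal ((L * R)⁻¹ * ℓ) := by
            rw [ENNReal.one_le_ofReal, ← div_eq_inv_mul, one_le_div (by positivity)]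
            exact hlen.le
        _ = ∫⁻ _t in Icc 0 ℓ, ENNReal.ofReal (L * R)⁻¹ := by
            rw [setLIntegral_const, Real.volume_Icc, sub_zero,
              ENNReal.ofReal_mul (by positivity)]
        _ = ∫⁻ t in Icc 0 ℓ, h₂ (arclengthCurve γ t) := by
            refine setLIntegral_congr_fun measurableSet_Icc fun t ht ↦ ?_
            simp only [hh₂, indicator_of_mem (hout t ht)]
        _ ≤ _ := lintegral_mono fun t ↦ le_sup_right.trans le_sup_right
  have hI₁ : ∫⁻ v, h₁ v ^ Q ∂μ ≤ ENNReal.ofReal (m / 4) := by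
    calc ∫⁻ v, h₁ v ^ Q ∂μ = ∫⁻ v in U, ENNReal.ofReal (b⁻¹ ^ Q) * ρ v ^ Q ∂μ := by
          rw [← lintegral_indicator hUm]
          refine lintegral_congr fun v ↦ ?_
          by_cases hv : v ∈ U
          · rw [hh₁, indicator_of_mem hv, indicator_of_mem hv,
              ENNReal.mul_rpow_of_nonneg _ _ hQ0.le,
              ENNReal.ofReal_rpow_of_nonneg (by positivity) hQ0.le]
          · rw [hh₁, indicator_of_notMem hv, indicator_of_notMem hv, ENNReal.zero_rpow_of_pos hQ0]
      _ = ENNReal.ofReal (b⁻¹ ^ Q) * (μ.withDensity fun v ↦ ρ v ^ Q) U := by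
          rw [lintegral_const_mul _ (hρ.pow_const Q), withDensity_apply _ hUm]
      _ ≤ ENNReal.ofReal (b⁻¹ ^ Q) * (ENNReal.ofReal (1 + K) * ENNReal.ofReal φ) :=
          mul_le_mul_right ((measure_ball_le_potential _ z hR hK0.le).trans
            (mul_le_mul_right hpot _)) _
      _ = ENNReal.ofReal (m / 4) := by
          rw [← ENNReal.ofReal_mul (by positivity), ← ENNReal.ofReal_mul (by positivity),
            Real.inv_rpow hb0.le, hbQ]
          congr 1
          field_simp
  have hI₂ : ∫⁻ v, h₂ v ^ Q ∂μ ≤ ENNReal.ofReal (m / 4) := by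
    calc ∫⁻ v, h₂ v ^ Q ∂μ = ∫⁻ v in U, ENNReal.ofReal ((L * R)⁻¹ ^ Q) ∂μ := by
          rw [← lintegral_indicator hUm]
          refine lintegral_congr fun v ↦ ?_
          by_cases hv : v ∈ U
          · rw [hh₂, indicator_of_mem hv, indicator_of_mem hv,
              ENNReal.ofReal_rpow_of_nonneg (by positivity) hQ0.le]
          · rw [hh₂, indicator_of_notMem hv, indicator_of_notMem hv, ENNReal.zero_rpow_of_pos hQ0]
      _ = ENNReal.ofReal ((L * R)⁻¹ ^ Q) * μ U := setLIntegral_const _ _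
      _ ≤ ENNReal.ofReal ((L * R)⁻¹ ^ Q) * ENNReal.ofReal (C * (K * R) ^ Q) :=
          mul_le_mul_right (hup z _ (by positivity) hRd) _
      _ = ENNReal.ofReal (m / 4) := by
          have hRQ : R ^ Q ≠ 0 := (Real.rpow_pos_of_pos hR _).ne'
          have hKQ : K ^ Q ≠ 0 := (Real.rpow_pos_of_pos hK0 _).ne'
          rw [← ENNReal.ofReal_mul (by positivity), Real.inv_rpow (by positivity),
            Real.mul_rpow hL0.le hR.le, Real.mul_rpow hK0.le hR.le, hLQ]
          congr 1
          field_simp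
  have hfin : modulus Q μ Γ ≤ ENNReal.ofReal (3 * (m / 4)) := by
    calc modulus Q μ Γ ≤ ∫⁻ v, (w v ⊔ (h₁ v ⊔ h₂ v)) ^ Q ∂μ := modulus_le hadm
      _ ≤ ∫⁻ v, (w v ^ Q + (h₁ v ^ Q + h₂ v ^ Q)) ∂μ :=
          lintegral_mono fun v ↦ sup_rpow_le_add.trans (add_le_add le_rfl sup_rpow_le_add)
      _ = ∫⁻ v, w v ^ Q ∂μ + (∫⁻ v, h₁ v ^ Q ∂μ + ∫⁻ v, h₂ v ^ Q ∂μ) := by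
          rw [lintegral_add_left (hwm.pow_const Q), lintegral_add_left (hm₁.pow_const Q)]
      _ ≤ ENNReal.ofReal (m / 4) + (ENNReal.ofReal (m / 4) + ENNReal.ofReal (m / 4)) :=
          add_le_add hwQ (add_le_add hI₁ hI₂)
      _ = ENNReal.ofReal (3 * (m / 4)) := by
          rw [← ENNReal.ofReal_add (by positivity) (by positivity),
            ← ENNReal.ofReal_add (by positivity) (by positivity)]
          congr 1
          ring
  have := (ENNReal.ofReal_le_ofReal_iff (by positivity)).1 (hmod.trans hfin)
  linarith

end Step

/-! ### Bridging the gap between two sets that cross a common annulus. -/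

/-- `A` is a closed connected set that meets the closed ball `B(z, R)` and is not contained in
`B(z, 4 * R)`. -/
structure Crosses (A : Set Z) (z : Z) (R : ℝ) : Prop where
  isClosed : IsClosed A
  isPreconnected : IsPreconnected A
  exists_near : ∃ p ∈ A, dist p z ≤ R
  exists_far : ∃ q ∈ A, 4 * R ≤ dist q z

lemma crosses_image {f : ℝ → Z} (hf : LipschitzWith 1 f) {ℓ : ℝ} {s t : ℝ} (hs : s ∈ Icc 0 ℓ)
    (ht : t ∈ Icc 0 ℓ) {z : Z} {R : ℝ} (hsz : dist (f s) z ≤ R) (htz : 4 * R ≤ dist (f t) z) :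
    Crosses (f '' Icc 0 ℓ) z R where
  isClosed := (isCompact_Icc.image hf.continuous).isClosed
  isPreconnected := isPreconnected_Icc.image _ hf.continuous.continuousOn
  exists_near := ⟨f s, mem_image_of_mem _ hs, hsz⟩
  exists_far := ⟨f t, mem_image_of_mem _ ht, htz⟩

/-- Following a chain of points at geometrically decreasing scales to its limit. -/
lemma exists_limit_point [CompleteSpace Z] {N : Type*} (next : N → N) (center : N → Z) (r : N → ℝ)
    (S : N → Set Z) {lam : ℝ} (hlam : lam ≤ 1 / 2) (hr0 : ∀ G, 0 ≤ r G)
    (hr : ∀ G, r (next G) = lam * r G) (hS : ∀ G, S (next G) = S G)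
    (hclosed : ∀ G, IsClosed (S G)) (hmem : ∀ G, center (next G) ∈ S G)
    (hdist : ∀ G, dist (center G) (center (next G)) ≤ 4 * r G) :
    ∃ e : N → Z, ∀ G, e (next G) = e G ∧ e G ∈ S G ∧ dist (center G) (e G) ≤ 8 * r G := by
  have hiter : ∀ (j : ℕ) G, r (next^[j] G) = r G * lam ^ j := by
    intro j G
    induction j with
    | zero => simp
    | succ j ih => rw [Function.iterate_succ_apply', hr, ih, pow_succ]; ring
  have hSiter : ∀ (j : ℕ) G, S (next^[j] G) = S G := by
    intro j G
    induction j with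
    | zero => simp
    | succ j ih => rw [Function.iterate_succ_apply', hS, ih]
  have hgeom : ∀ G (j : ℕ), dist (center (next^[j] G)) (center (next^[j + 1] G)) ≤
      4 * r G * lam ^ j := by
    intro G j
    rw [Function.iterate_succ_apply', mul_assoc, ← hiter]
    exact hdist _
  have hlt : lam < 1 := by linarith
  have hlim : ∀ G, ∃ z, Tendsto (fun j ↦ center (next^[j] G)) atTop (𝓝 z) := fun G ↦
    cauchySeq_tendsto_of_complete (cauchySeq_of_le_geometric lam _ hlt (hgeom G))
  choose e he using hlim
  refine ⟨e, fun G ↦ ⟨?_, ?_, ?_⟩⟩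
  · refine tendsto_nhds_unique (he (next G)) (((he G).comp (tendsto_add_atTop_nat 1)).congr ?_)
    exact fun j ↦ by simp
  · refine (hclosed G).mem_of_tendsto ((he G).comp (tendsto_add_atTop_nat 1))
      (Eventually.of_forall fun j ↦ ?_)
    rw [Function.comp_apply, Function.iterate_succ_apply', ← hSiter j G]
    exact hmem _
  · refine (dist_le_of_le_geometric_of_tendsto₀ lam _ hlt (hgeom G) (he G)).trans ?_
    rw [div_le_iff₀ (by linarith)]
    nlinarith [hr0 G]

section Bridging

variable [MeasurableSpace Z] [BorelSpace Z]

/-- If `A` and `B` cross an annulus around `z`, then they are almost joined by a short curve `f`: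
there remain gaps between `A` and `f` and between `f` and `B`, at a smaller scale and with a much
smaller potential. -/
lemma exists_curve_between {μ : Measure Z} {Q C : ℝ} (hQ : 1 < Q) (hC : 0 < C)
    (hup : ∀ (a : Z) (R : ℝ), 0 < R → ENNReal.ofReal R ≤ Metric.ediam (univ : Set Z) →
      μ (Metric.ball a R) ≤ ENNReal.ofReal (C * R ^ Q)) {Ψ : ℝ → ℝ} (hΨ : IsLoewnerFunction Ψ)
    (hb : BallLoewner Q μ Ψ) {n : ℕ} (hn : 32 ≤ n) :
    ∃ K L c : ℝ, 0 < K ∧ 0 < L ∧ 0 < c ∧ ∀ (z : Z) (R φ : ℝ), 0 < R → 0 < φ →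
      ENNReal.ofReal (K * R) ≤ Metric.ediam (univ : Set Z) →
      ∀ ρ : Z → ℝ≥0∞, Measurable ρ →
      potential (μ.withDensity fun v ↦ ρ v ^ Q) z R ≤ ENNReal.ofReal φ →
      ∀ A B : Set Z, Crosses A z R → Crosses B z R →
      ∃ (x y : Z) (f : ℝ → Z) (ℓ : ℝ), LipschitzWith 1 f ∧ ℓ ≤ L * R ∧
        ∫⁻ t in Icc 0 ℓ, ρ (f t) ≤ ENNReal.ofReal (c * φ ^ (1 / Q)) ∧
        x ∈ A ∧ y ∈ B ∧ dist z x ≤ 4 * R ∧ dist z y ≤ 4 * R ∧ R ≤ dist x y ∧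
        potential (μ.withDensity fun v ↦ ρ v ^ Q) x (R / n) ≤
          ENNReal.ofReal (9 * doubleHarmonic n / n * φ) ∧
        potential (μ.withDensity fun v ↦ ρ v ^ Q) y (R / n) ≤
          ENNReal.ofReal (9 * doubleHarmonic n / n * φ) ∧
        Crosses A x (R / n) ∧ Crosses (f '' Icc 0 ℓ) x (R / n) ∧
        Crosses (f '' Icc 0 ℓ) y (R / n) ∧ Crosses B y (R / n) := by
  have hn' : (32 : ℝ) ≤ n := by exact_mod_cast hn
  have hn0 : (0 : ℝ) < n := by linarith
  -- The balls will have radius `s = R / n` and diameter at least `s / 2`, with centres at most `6 *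
  -- R = 12 * n * (s / 2)` apart.
  obtain ⟨K, L, c, hK, hL, hc, hpath⟩ := exists_short_path hQ hC hup
    (hΨ.1 (12 * n) (by positivity))
  refine ⟨K, L, c, hK, hL, hc, fun z R φ hR hφ hRd ρ hρ hpot A B hA hB ↦ ?_⟩
  set ν := μ.withDensity fun v ↦ ρ v ^ Q with hν
  obtain ⟨pA, hpA, hpAz⟩ := hA.exists_near
  obtain ⟨qA, hqA, hqAz⟩ := hA.exists_far
  obtain ⟨pB, hpB, hpBz⟩ := hB.exists_near
  obtain ⟨qB, hqB, hqBz⟩ := hB.exists_far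
  -- Taking `x` at distance in `[R, 2 * R]` and `y` at distance in `[3 * R, 4 * R]` from `z` keeps
  -- them `R` apart.
  obtain ⟨x, hx, hx1, hx2, hxp⟩ := exists_potential_le ν (n := n) (by omega) hR hA.isPreconnected
    hpA hqA hpAz hqAz (a := R) le_rfl (by linarith)
  obtain ⟨y, hy, hy1, hy2, hyp⟩ := exists_potential_le ν (n := n) (by omega) hR hB.isPreconnected
    hpB hqB hpBz hqBz (a := 3 * R) (by linarith) le_rfl
  have hη : 0 ≤ 9 * doubleHarmonic n / n := by
    have := two_le_doubleHarmonic (n := n) (by omega)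
    positivity
  have hp : ∀ {v : Z}, potential ν v (R / n) ≤ ENNReal.ofReal (9 * doubleHarmonic n / n) *
      potential ν z R → potential ν v (R / n) ≤ ENNReal.ofReal (9 * doubleHarmonic n / n * φ) := by
    intro v hv
    rw [ENNReal.ofReal_mul hη]
    exact hv.trans (mul_le_mul_right hpot _)
  set s := R / n with hs
  have hs0 : 0 < s := div_pos hR hn0
  have hRs : R = n * s := by rw [hs]; field_simp
  -- This leaves room to cross at scale `s`: the end of the new curve near `y` is at distance at
  -- least `R - s ≥ 4 * s` from `x`, and conversely.
  have h32 : 32 * s ≤ R := by rw [hRs]; exact mul_le_mul_of_nonneg_right hn' hs0.le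
  have hxy : R ≤ dist x y := by linarith [dist_triangle_left y z x, dist_comm x y]
  have hxy' : dist x y ≤ 6 * R := by linarith [dist_triangle_right x y z]
  have hqx : 2 * R ≤ dist qA x := by linarith [dist_triangle qA x z]
  have hpy : 2 * R ≤ dist pB y := by linarith [dist_triangle_left y z pB]
  obtain ⟨x', -, hx'⟩ := exists_dist_eq_of_isPreconnected hA.isPreconnected hx hqA
    (s := s / 2) (by linarith) (by linarith)
  obtain ⟨y', -, hy'⟩ := exists_dist_eq_of_isPreconnected hB.isPreconnected hy hpB
    (s := s / 2) (by linarith) (by linarith)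
  have hmod := hb.le_modulus hΨ (s := s) (T := 12 * n) (half_pos hs0) (half_lt_self hs0) hx' hy'
    (by linarith) (by rw [hRs] at hxy'; linarith)
  obtain ⟨γ, hγ, hγr, hγl, hγρ⟩ := hpath z R φ hR hφ hRd ρ hρ hpot _ (fun γ hγ ↦ by
    have h1 := hγ.1
    rw [Metric.mem_ball] at h1 ⊢
    linarith [dist_triangle (γ 0) x z]) hmod
  rw [lineIntegral_eq_arclengthCurve] at hγρ
  have h0 : dist (arclengthCurve γ 0) x < s := by
    rw [hγr.arclengthCurve_zero]; exact hγ.1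
  have h1 : dist (arclengthCurve γ (pathLength γ).toReal) y < s := by
    rw [hγr.arclengthCurve_length]; exact hγ.2
  have hm0 : (0 : ℝ) ∈ Icc 0 (pathLength γ).toReal := ⟨le_rfl, ENNReal.toReal_nonneg⟩
  have hm1 : (pathLength γ).toReal ∈ Icc 0 (pathLength γ).toReal :=
    ⟨ENNReal.toReal_nonneg, le_rfl⟩
  refine ⟨x, y, arclengthCurve γ, (pathLength γ).toReal, hγr.lipschitzWith_arclengthCurve, hγl, hγρ,
    hx, hy, by rw [dist_comm]; linarith, by rw [dist_comm]; linarith, hxy, hp hxp, hp hyp,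
    ⟨hA.isClosed, hA.isPreconnected, ⟨x, hx, by simp [hs0.le]⟩, qA, hqA, by linarith⟩,
    crosses_image hγr.lipschitzWith_arclengthCurve hm0 hm1 h0.le ?_,
    crosses_image hγr.lipschitzWith_arclengthCurve hm1 hm0 h1.le ?_,
    ⟨hB.isClosed, hB.isPreconnected, ⟨y, hy, by simp [hs0.le]⟩, pB, hpB, by linarith⟩⟩
  · linarith [dist_triangle_left x y (arclengthCurve γ (pathLength γ).toReal)]
  · linarith [dist_triangle_left x y (arclengthCurve γ 0)]

/-- A pair of sets that cross an annulus around `center` at scale `R * lam ^ level`, where the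
potential is at most `φ * η ^ level`. -/
structure GapNode (ν : Measure Z) (R lam φ η : ℝ) where
  level : ℕ
  srcSet : Set Z
  tgtSet : Set Z
  center : Z
  crosses_src : Crosses srcSet center (R * lam ^ level)
  crosses_tgt : Crosses tgtSet center (R * lam ^ level)
  potential_le : potential ν center (R * lam ^ level) ≤ ENNReal.ofReal (φ * η ^ level)

/-- Two closed connected sets that cross an annulus of radius small compared to the diameter of the
space are joined by a curve along which the integral of `ρ` is controlled by its `L ^ Q` norm. -/
theorem exists_joinedByCurve_of_crosses [CompleteSpace Z] {μ : Measure Z} {Q C : ℝ} (hQ : 1 < Q)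
    (hC : 0 < C)
    (hup : ∀ (a : Z) (R : ℝ), 0 < R → ENNReal.ofReal R ≤ Metric.ediam (univ : Set Z) →
      μ (Metric.ball a R) ≤ ENNReal.ofReal (C * R ^ Q)) {Ψ : ℝ → ℝ} (hΨ : IsLoewnerFunction Ψ)
    (hb : BallLoewner Q μ Ψ) :
    ∃ K C₁ : ℝ, 0 < K ∧ 0 < C₁ ∧ ∀ (z : Z) (R φ : ℝ), 0 < R → 0 < φ →
      ENNReal.ofReal (K * R) ≤ Metric.ediam (univ : Set Z) →
      ∀ ρ : Z → ℝ≥0∞, Measurable ρ → ∫⁻ v, ρ v ^ Q ∂μ ≤ ENNReal.ofReal φ →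
      ∀ A B : Set Z, Crosses A z R → Crosses B z R →
      ∃ p ∈ A, ∃ q ∈ B, ∃ ℓ : ℝ, 0 ≤ ℓ ∧
        JoinedByCurve ρ p q ℓ (ENNReal.ofReal (C₁ * φ ^ (1 / Q))) := by
  have hQ0 : 0 < Q := by linarith
  -- Here `2 * η ^ (1 / Q)` is the ratio of the costs of successive generations: twice as many gaps,
  -- each with its potential multiplied by `η`.
  have hlim : Tendsto (fun n : ℕ ↦ 2 * (9 * (doubleHarmonic n / n)) ^ (1 / Q)) atTop (𝓝 0) := by
    have h1 := (tendsto_doubleHarmonic_div.const_mul 9).rpow_const (p := 1 / Q)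
      (Or.inr (by positivity))
    have h2 := h1.const_mul 2
    rwa [mul_zero, Real.zero_rpow (by positivity), mul_zero] at h2
  obtain ⟨n, hθ1, hn⟩ :=
    ((hlim.eventually_lt_const zero_lt_one).and (eventually_ge_atTop 32)).exists
  rw [← mul_div_assoc] at hθ1
  set η : ℝ := 9 * doubleHarmonic n / n with hη
  set θ : ℝ := 2 * η ^ (1 / Q) with hθ
  have hn' : (32 : ℝ) ≤ n := by exact_mod_cast hn
  have hn0 : (0 : ℝ) < n := by linarith
  have hη0 : 0 < η := by
    have := two_le_doubleHarmonic (n := n) (by omega)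
    positivity
  have hθ0 : 0 < θ := mul_pos two_pos (Real.rpow_pos_of_pos hη0 _)
  set lam : ℝ := 1 / n with hlam
  have hlam0 : 0 < lam := by positivity
  have hlam1 : lam ≤ 1 / 32 := one_div_le_one_div_of_le (by norm_num) hn'
  obtain ⟨K, L, c, hK, hL, hc, hstep⟩ := exists_curve_between hQ hC hup hΨ hb hn
  refine ⟨K, 2 * L * c / (1 - θ), hK, div_pos (by positivity) (by linarith),
    fun z R φ hR hφ hRd ρ hρ hρφ A B hA hB ↦ ?_⟩
  set ν := μ.withDensity fun v ↦ ρ v ^ Q with hν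
  have hstep' : ∀ G : GapNode ν R lam φ η, ∃ (x y : Z) (f : ℝ → Z) (ℓ : ℝ),
      LipschitzWith 1 f ∧ ℓ ≤ L * (R * lam ^ G.level) ∧
        ∫⁻ t in Icc 0 ℓ, ρ (f t) ≤ ENNReal.ofReal (c * (φ * η ^ G.level) ^ (1 / Q)) ∧
        x ∈ G.srcSet ∧ y ∈ G.tgtSet ∧ dist G.center x ≤ 4 * (R * lam ^ G.level) ∧
        dist G.center y ≤ 4 * (R * lam ^ G.level) ∧ R * lam ^ G.level ≤ dist x y ∧
        potential ν x (R * lam ^ (G.level + 1)) ≤ ENNReal.ofReal (φ * η ^ (G.level + 1)) ∧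
        potential ν y (R * lam ^ (G.level + 1)) ≤ ENNReal.ofReal (φ * η ^ (G.level + 1)) ∧
        Crosses G.srcSet x (R * lam ^ (G.level + 1)) ∧
        Crosses (f '' Icc 0 ℓ) x (R * lam ^ (G.level + 1)) ∧
        Crosses (f '' Icc 0 ℓ) y (R * lam ^ (G.level + 1)) ∧
        Crosses G.tgtSet y (R * lam ^ (G.level + 1)) := by
    intro G
    have h1 : R * lam ^ (G.level + 1) = R * lam ^ G.level / n := by
      rw [pow_succ, ← mul_assoc]
      exact mul_one_div _ _
    have h2 : φ * η ^ (G.level + 1) = η * (φ * η ^ G.level) := by rw [pow_succ]; ring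
    rw [h1, h2]
    refine hstep G.center _ _ (by positivity) (by positivity) ?_ ρ hρ G.potential_le _ _
      G.crosses_src G.crosses_tgt
    refine le_trans (ENNReal.ofReal_le_ofReal (mul_le_mul_of_nonneg_left ?_ hK.le)) hRd
    exact mul_le_of_le_one_right hR.le (pow_le_one₀ hlam0.le (by linarith))
  choose x y f ℓ hf hℓ hfρ hx hy hzx hzy hxy hpx hpy hAx hfx hfy hBy using hstep'
  let left (G : GapNode ν R lam φ η) : GapNode ν R lam φ η :=
    ⟨G.level + 1, G.srcSet, f G '' Icc 0 (ℓ G), x G, hAx G, hfx G, hpx G⟩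
  let right (G : GapNode ν R lam φ η) : GapNode ν R lam φ η :=
    ⟨G.level + 1, f G '' Icc 0 (ℓ G), G.tgtSet, y G, hfy G, hBy G, hpy G⟩
  have hscale : ∀ k : ℕ, R * lam ^ (k + 1) = lam * (R * lam ^ k) := fun k ↦ by rw [pow_succ]; ring
  -- Iterated left children keep the source set and have their centres on it; their limit is the
  -- point of that set where the bridge starts. Right children give its end in the same way.
  obtain ⟨src, hsrc⟩ := exists_limit_point left (fun G ↦ G.center) (fun G ↦ R * lam ^ G.level)
    (fun G ↦ G.srcSet) (lam := lam) (by linarith) (fun G ↦ by positivity) (fun G ↦ hscale _)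
    (fun G ↦ rfl) (fun G ↦ G.crosses_src.isClosed) hx hzx
  obtain ⟨tgt, htgt⟩ := exists_limit_point right (fun G ↦ G.center) (fun G ↦ R * lam ^ G.level)
    (fun G ↦ G.tgtSet) (lam := lam) (by linarith) (fun G ↦ by positivity) (fun G ↦ hscale _)
    (fun G ↦ rfl) (fun G ↦ G.crosses_tgt.isClosed) hy hzy
  have hmid : ∀ G, JoinedByCurve ρ (tgt (left G)) (src (right G)) (L * R * lam ^ G.level)
      (ENNReal.ofReal (2 * L * c * (φ * η ^ G.level) ^ (1 / Q))) := by
    intro G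
    obtain ⟨-, ⟨s, hs, hs'⟩, hds⟩ := htgt (left G)
    obtain ⟨-, ⟨t, ht, ht'⟩, hdt⟩ := hsrc (right G)
    set r := R * lam ^ G.level with hr
    have hr0 : 0 < r := by positivity
    have hr1 : R * lam ^ (G.level + 1) ≤ r / 32 := by
      rw [hscale, ← hr]; nlinarith
    change dist (x G) (tgt (left G)) ≤ 8 * (R * lam ^ (G.level + 1)) at hds
    change dist (y G) (src (right G)) ≤ 8 * (R * lam ^ (G.level + 1)) at hdt
    -- The ends of the middle part lie within `r / 4` of `x G` and `y G`, which are `r` apart. Hence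
    -- slowing it down to the prescribed time `L * r` costs at most a factor `2 * L`.
    have hst : r / 2 ≤ |t - s| := by
      have h1 := (hf G).dist_le_mul s t
      rw [hs', ht', NNReal.coe_one, one_mul, dist_comm s, Real.dist_eq] at h1
      have h2 := dist_triangle4 (x G) (tgt (left G)) (src (right G)) (y G)
      have h3 := hxy G
      rw [dist_comm (src (right G)) (y G)] at h2
      linarith
    have hst' : |t - s| ≤ L * R * lam ^ G.level := by
      rw [mul_assoc, ← hr]
      refine le_trans ?_ (hℓ G)
      rw [abs_le]
      constructor <;> linarith [hs.1, hs.2, ht.1, ht.2]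
    have hne : s ≠ t := by
      rintro rfl
      rw [sub_self, abs_zero] at hst
      linarith
    obtain ⟨g, hg, hg0, hg1, hgρ⟩ := joinedByCurve_of_lipschitzWith ρ (hf G) hs ht hne hst'
    refine ⟨g, hg, hg0.trans hs', hg1.trans ht', hgρ.trans ?_⟩
    refine (mul_le_mul (ENNReal.ofReal_le_ofReal (q := 2 * L) ?_) (hfρ G) zero_le
      zero_le).trans_eq ?_
    · rw [div_le_iff₀ (by linarith), mul_assoc L, ← hr]
      nlinarith
    · rw [← ENNReal.ofReal_mul (by positivity)]
      congr 1
      ring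
  choose mid hmidl hmid0 hmid1 hmidρ using hmid
  let T : GapTree (GapNode ν R lam φ η) ρ (L * R) (16 * R) lam
      (fun k ↦ ENNReal.ofReal (2 * L * c * (φ * η ^ k) ^ (1 / Q))) :=
    { level := fun G ↦ G.level
      left := left
      right := right
      src := src
      tgt := tgt
      mid := mid
      level_left := fun G ↦ rfl
      level_right := fun G ↦ rfl
      src_left := fun G ↦ (hsrc G).1
      tgt_right := fun G ↦ (htgt G).1
      dist_le := fun G ↦ by
        have h1 := (hsrc G).2.2
        have h2 := (htgt G).2.2
        linarith [dist_triangle_left (src G) (tgt G) G.center]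
      lipschitz_mid := hmidl
      mid_zero := hmid0
      mid_length := hmid1
      lintegral_mid_le := hmidρ }
  have hpot : potential ν z (R * lam ^ 0) ≤ ENNReal.ofReal (φ * η ^ 0) := by
    rw [pow_zero, pow_zero, mul_one, mul_one]
    refine (potential_le_measure_univ ν z hR).trans ?_
    rwa [hν, withDensity_apply _ MeasurableSet.univ, setLIntegral_univ]
  let G₀ : GapNode ν R lam φ η :=
    ⟨0, A, B, z, by simpa using hA, by simpa using hB, hpot⟩
  refine ⟨src G₀, (hsrc G₀).2.1, tgt G₀, (htgt G₀).2.1, L * R / (1 - 2 * lam),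
    div_nonneg (by positivity) (by linarith), ?_⟩
  refine T.joinedByCurve (by positivity) (by positivity) hlam0 (by linarith) (fun m ↦ ?_)
    (G := G₀) rfl
  have hterm : ∀ k : ℕ, 2 ^ k * ENNReal.ofReal (2 * L * c * (φ * η ^ k) ^ (1 / Q)) =
      ENNReal.ofReal (2 * L * c * φ ^ (1 / Q) * θ ^ k) := by
    intro k
    rw [← ENNReal.ofReal_ofNat, ← ENNReal.ofReal_pow (by norm_num),
      ← ENNReal.ofReal_mul (by positivity), Real.mul_rpow hφ.le (by positivity), hθ, mul_pow,
      ← Real.rpow_natCast (η ^ (1 / Q)), ← Real.rpow_mul hη0.le, ← Real.rpow_natCast η,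
      ← Real.rpow_mul hη0.le, mul_comm (1 / Q)]
    congr 1
    ring
  have hφQ : 0 < φ ^ (1 / Q) := Real.rpow_pos_of_pos hφ _
  simp only [hterm]
  rw [← ENNReal.ofReal_sum_of_nonneg fun k _ ↦ by positivity, ← Finset.mul_sum]
  refine ENNReal.ofReal_le_ofReal ?_
  have hgeo : ∑ k ∈ Finset.range m, θ ^ k ≤ (1 - θ)⁻¹ := by
    rw [← tsum_geometric_of_lt_one hθ0.le hθ1]
    exact (summable_geometric_of_lt_one hθ0.le hθ1).sum_le_tsum _ fun k _ ↦ by positivity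
  refine (mul_le_mul_of_nonneg_left hgeo (by positivity)).trans_eq ?_
  rw [← div_eq_mul_inv]
  ring

end Bridging

/-! ### Modulus of the paths between two continua. -/

lemma exists_far_of_ediam {F : Set Z} {r : ℝ} (hr : 0 < r)
    (hF : ENNReal.ofReal r ≤ Metric.ediam F) (x : Z) : ∃ q ∈ F, r / 4 ≤ dist q x := by
  by_contra! h
  have h1 : Metric.ediam F ≤ ENNReal.ofReal (r / 2) := by
    refine Metric.ediam_le fun u hu v hv ↦ ?_
    rw [edist_dist]
    refine ENNReal.ofReal_le_ofReal ?_
    linarith [h u hu, h v hv, dist_triangle_right u v x]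
  have := (ENNReal.ofReal_le_ofReal_iff (by positivity)).1 (hF.trans h1)
  linarith

lemma exists_joinedByCurve_image (ρ : Z → ℝ≥0∞) {f : ℝ → Z} (hf : LipschitzWith 1 f) {ℓ : ℝ}
    {p q : Z} (hp : p ∈ f '' Icc 0 ℓ) (hq : q ∈ f '' Icc 0 ℓ) :
    ∃ ℓ' : ℝ, 0 ≤ ℓ' ∧ JoinedByCurve ρ p q ℓ' (∫⁻ t in Icc 0 ℓ, ρ (f t)) := by
  obtain ⟨s, hs, rfl⟩ := hp
  obtain ⟨t, ht, rfl⟩ := hq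
  rcases eq_or_ne s t with rfl | hst
  · exact ⟨0, le_rfl, fun _ ↦ f s, LipschitzWith.const' _, rfl, rfl, by simp⟩
  · have h := joinedByCurve_of_lipschitzWith ρ hf hs ht hst le_rfl
    rw [div_self (abs_pos.2 (sub_ne_zero.2 hst.symm)).ne', ENNReal.ofReal_one, one_mul] at h
    exact ⟨_, abs_nonneg _, h⟩

/-- A connected set of diameter at least `r` that contains a point at distance at most `T ≥ r` from
`x` contains a point whose distance from `x` lies between `r / 4` and `T`. -/
lemma exists_mem_dist_ge {F : Set Z} (hF : IsPreconnected F) {r T : ℝ} (hr : 0 < r)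
    (hrF : ENNReal.ofReal r ≤ Metric.ediam F) (hrT : r ≤ T) {x y₀ : Z} (hy₀ : y₀ ∈ F)
    (hT : dist x y₀ ≤ T) : ∃ y ∈ F, r / 4 ≤ dist x y ∧ dist x y ≤ T := by
  rcases le_or_gt (r / 4) (dist x y₀) with h | h
  · exact ⟨y₀, hy₀, h, hT⟩
  obtain ⟨q, hq, hqx⟩ := exists_far_of_ediam hr hrF x
  obtain ⟨y, hy, hyx⟩ := hF.intermediate_value hy₀ hq
    (continuous_id.dist continuous_const).continuousOn (f := fun v ↦ dist v x)
    (show r / 4 ∈ Icc (dist y₀ x) (dist q x) from ⟨by rw [dist_comm]; exact h.le, hqx⟩)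
  simp only at hyx
  rw [dist_comm] at hyx
  exact ⟨y, hy, hyx.ge, by linarith⟩

/-- The summand `1` makes the bound strictly larger than the infimum `setDist`, so no minimizing
pair is needed. -/
lemma exists_dist_le_of_setDist {E F : Set Z} (hE : E.Nonempty) (hF : F.Nonempty) {r : ℝ}
    (hr : 0 < r) (hrEF : ENNReal.ofReal r = min (Metric.ediam E) (Metric.ediam F)) :
    ∃ x ∈ E, ∃ y ∈ F, dist x y ≤ (relDist E F + 1) * r := by
  obtain ⟨x₀, hx₀⟩ := hE
  obtain ⟨y₀, hy₀⟩ := hF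
  have hfin : setDist E F ≠ ∞ := ne_top_of_le_ne_top (edist_ne_top x₀ y₀) (setDist_le hx₀ hy₀)
  have hr' : 0 < ENNReal.ofReal r := ENNReal.ofReal_pos.2 hr
  have hrel : setDist E F = ENNReal.ofReal (relDist E F * r) := by
    rw [relDist, ← hrEF, ENNReal.ofReal_mul ENNReal.toReal_nonneg,
      ENNReal.ofReal_toReal (ENNReal.div_ne_top hfin hr'.ne'),
      ENNReal.div_mul_cancel hr'.ne' ENNReal.ofReal_ne_top]
  have hlt : setDist E F < ENNReal.ofReal ((relDist E F + 1) * r) := by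
    rw [hrel]
    have h0 : 0 ≤ relDist E F := ENNReal.toReal_nonneg
    refine (ENNReal.ofReal_lt_ofReal_iff (by positivity)).2 ?_
    linarith
  simp only [setDist, iInf_lt_iff] at hlt
  obtain ⟨x, hx, y, hy, h⟩ := hlt
  refine ⟨x, hx, y, hy, ?_⟩
  rw [edist_dist] at h
  exact ((ENNReal.ofReal_lt_ofReal_iff'.1 h).1).le

section Modulus

variable [MeasurableSpace Z] [BorelSpace Z]

/-- Otherwise `4 * ρ` would be admissible, with too little energy. -/
lemma exists_path_lineIntegral_le {μ : Measure Z} {Q : ℝ} (hQ : 0 < Q) {Γ : Set C(I, Z)}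
    {ρ : Z → ℝ≥0∞} (hρ : Measurable ρ)
    (h : ENNReal.ofReal (4 ^ Q) * ∫⁻ v, ρ v ^ Q ∂μ < modulus Q μ Γ) :
    ∃ γ ∈ Γ, IsRectifiable γ ∧ lineIntegral ρ γ ≤ ENNReal.ofReal (1 / 4) := by
  by_contra! hcon
  have hadm : IsAdmissible Γ fun v ↦ ENNReal.ofReal 4 * ρ v := by
    refine ⟨hρ.const_mul _, fun γ hγ hγr ↦ ?_⟩
    rw [lineIntegral_eq_arclengthCurve]
    have h1 := lintegral_const_mul (μ := volume.restrict (Icc 0 (pathLength γ).toReal))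
      (ENNReal.ofReal 4) (hρ.comp hγr.lipschitzWith_arclengthCurve.continuous.measurable)
    simp only [Function.comp_apply] at h1
    rw [h1, ← lineIntegral_eq_arclengthCurve]
    refine le_trans ?_ (mul_le_mul_right (hcon γ hγ hγr).le _)
    rw [← ENNReal.ofReal_mul (by norm_num)]
    norm_num
  refine absurd h (not_lt.2 ((modulus_le hadm).trans_eq ?_))
  rw [← lintegral_const_mul _ (hρ.pow_const Q)]
  refine lintegral_congr fun v ↦ ?_
  rw [ENNReal.mul_rpow_of_nonneg _ _ hQ.le, ENNReal.ofReal_rpow_of_nonneg (by norm_num) hQ.le]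

/-- The lower bound for the modulus of the paths that connect two continua. -/
theorem exists_loewnerFunction [CompleteSpace Z] {μ : Measure Z} {Q C : ℝ} (hQ : 1 < Q)
    (hC : 0 < C)
    (hup : ∀ (a : Z) (R : ℝ), 0 < R → ENNReal.ofReal R ≤ Metric.ediam (univ : Set Z) →
      μ (Metric.ball a R) ≤ ENNReal.ofReal (C * R ^ Q)) {Ψ : ℝ → ℝ} (hΨ : IsLoewnerFunction Ψ)
    (hb : BallLoewner Q μ Ψ) :
    ∃ Φ : ℝ → ℝ, IsLoewnerFunction Φ ∧ ∀ E F : Set Z, IsNondegenerateContinuum E →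
      IsNondegenerateContinuum F →
      ENNReal.ofReal (Φ (relDist E F)) ≤ modulus Q μ (connectingPaths E F) := by
  have hQ0 : 0 < Q := by linarith
  obtain ⟨K, C₁, hK, hC₁, hlocal⟩ := exists_joinedByCurve_of_crosses hQ hC hup hΨ hb
  -- With radius `s = κ * r`, the bound `1 / K` gives `K * s ≤ r`, at most the diameter of the
  -- space, and `1 / 32` makes `s` small compared to the separation `r / 4`.
  set κ : ℝ := min (1 / 32) (1 / K) with hκ
  have hκ0 : 0 < κ := lt_min (by norm_num) (by positivity)
  have hκ1 : κ ≤ 1 / 32 := min_le_left _ _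
  have hκK : K * κ ≤ 1 := by
    have := mul_le_mul_of_nonneg_left (min_le_right (1 / 32) (1 / K)) hK.le
    rwa [mul_one_div_cancel hK.ne'] at this
  have h4 : (0 : ℝ) < 4 ^ Q := Real.rpow_pos_of_pos (by norm_num) _
  have harg : ∀ t : ℝ, 0 ≤ t → 0 < 2 * (t + 1) / κ := fun t ht ↦ by positivity
  -- The first term provides a path between the balls of cost at most `1 / 4`; the second makes each
  -- of the two bridges cost at most `1 / 8`. The sum is `1 / 2 < 1`.
  refine ⟨fun t ↦ min (Ψ (2 * (t + 1) / κ) / 4 ^ Q) ((1 / (8 * C₁)) ^ Q), ⟨fun t ht ↦ ?_, ?_⟩, ?_⟩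
  · exact lt_min (div_pos (hΨ.1 _ (harg t ht.le)) h4) (Real.rpow_pos_of_pos (by positivity) _)
  · intro s hs t ht hst
    refine min_le_min (div_le_div_of_nonneg_right (hΨ.2 (harg s hs.le) (harg t ht.le) ?_) h4.le)
      le_rfl
    gcongr
  intro E F hE hF
  refine le_iInf₂ fun ρ hρ ↦ ?_
  by_contra! hlt
  obtain ⟨hEc, hEconn, hEn⟩ := hE
  obtain ⟨hFc, hFconn, hFn⟩ := hF
  set δ := relDist E F with hδ
  have hδ0 : 0 ≤ δ := ENNReal.toReal_nonneg
  set φ : ℝ := min (Ψ (2 * (δ + 1) / κ) / 4 ^ Q) ((1 / (8 * C₁)) ^ Q) with hφ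
  have hφ0 : 0 < φ :=
    lt_min (div_pos (hΨ.1 _ (harg δ hδ0)) h4) (Real.rpow_pos_of_pos (by positivity) _)
  have hmin0 : min (Metric.ediam E) (Metric.ediam F) ≠ 0 :=
    (lt_min (Metric.ediam_pos_iff.2 hEn) (Metric.ediam_pos_iff.2 hFn)).ne'
  have hmint : min (Metric.ediam E) (Metric.ediam F) ≠ ∞ :=
    ne_top_of_le_ne_top hEc.isBounded.ediam_ne_top (min_le_left _ _)
  obtain ⟨r, hr, hrEF⟩ : ∃ r : ℝ, 0 < r ∧
      ENNReal.ofReal r = min (Metric.ediam E) (Metric.ediam F) :=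
    ⟨_, ENNReal.toReal_pos hmin0 hmint, ENNReal.ofReal_toReal hmint⟩
  have hrE : ENNReal.ofReal r ≤ Metric.ediam E := hrEF.trans_le (min_le_left _ _)
  have hrF : ENNReal.ofReal r ≤ Metric.ediam F := hrEF.trans_le (min_le_right _ _)
  obtain ⟨x, hx, y₀, hy₀, hxy₀⟩ := exists_dist_le_of_setDist hEconn.nonempty hFconn.nonempty hr hrEF
  -- The point `y₀` may be too close to `x` for separated balls; `y` is at distance at least `r / 4
  -- ≥ 8 * s`.
  obtain ⟨y, hy, hxy, hxy'⟩ := exists_mem_dist_ge hFconn.isPreconnected hr hrF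
    (T := (δ + 1) * r) (by nlinarith) hy₀ hxy₀
  obtain ⟨qE, hqE, hqEx⟩ := exists_far_of_ediam hr hrE x
  obtain ⟨qF, hqF, hqFy⟩ := exists_far_of_ediam hr hrF y
  set s : ℝ := κ * r with hs
  have hs0 : 0 < s := mul_pos hκ0 hr
  have hsr : s ≤ r / 32 := by rw [hs]; nlinarith
  obtain ⟨x', -, hx'⟩ := exists_dist_eq_of_isPreconnected hEconn.isPreconnected hx hqE
    (s := s / 2) (by linarith) (by linarith)
  obtain ⟨y', -, hy'⟩ := exists_dist_eq_of_isPreconnected hFconn.isPreconnected hy hqF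
    (s := s / 2) (by linarith) (by linarith)
  have hmod := hb.le_modulus hΨ (s := s) (T := 2 * (δ + 1) / κ) (half_pos hs0) (half_lt_self hs0)
    hx' hy' (by linarith) (by
      refine hxy'.trans_eq ?_
      rw [hs]
      field_simp)
  obtain ⟨γ, hγ, hγr, hγρ⟩ := exists_path_lineIntegral_le (μ := μ) hQ0 hρ.1 (Γ := connectingPaths
    (Metric.ball x s) (Metric.ball y s)) (by
      refine lt_of_lt_of_le ?_ hmod
      refine lt_of_lt_of_le (ENNReal.mul_lt_mul_right (ENNReal.ofReal_pos.2 h4).ne'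
        ENNReal.ofReal_ne_top hlt) ?_
      rw [← ENNReal.ofReal_mul h4.le]
      refine ENNReal.ofReal_le_ofReal ?_
      have := mul_le_mul_of_nonneg_left
        (min_le_left (Ψ (2 * (δ + 1) / κ) / 4 ^ Q) ((1 / (8 * C₁)) ^ Q)) h4.le
      rwa [mul_div_cancel₀ _ h4.ne'] at this)
  rw [lineIntegral_eq_arclengthCurve] at hγρ
  have hcurve := hγr.lipschitzWith_arclengthCurve
  have h0 : dist (arclengthCurve γ 0) x < s := by
    rw [hγr.arclengthCurve_zero]; exact hγ.1
  have h1 : dist (arclengthCurve γ (pathLength γ).toReal) y < s := by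
    rw [hγr.arclengthCurve_length]; exact hγ.2
  have hm0 : (0 : ℝ) ∈ Icc 0 (pathLength γ).toReal := ⟨le_rfl, ENNReal.toReal_nonneg⟩
  have hm1 : (pathLength γ).toReal ∈ Icc 0 (pathLength γ).toReal :=
    ⟨ENNReal.toReal_nonneg, le_rfl⟩
  have hRd : ENNReal.ofReal (K * s) ≤ Metric.ediam (univ : Set Z) := by
    refine le_trans (ENNReal.ofReal_le_ofReal ?_) (hrE.trans (Metric.ediam_mono (subset_univ E)))
    rw [hs, ← mul_assoc]
    exact mul_le_of_le_one_left hr.le hκK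
  have hφ1 : C₁ * φ ^ (1 / Q) ≤ 1 / 8 := by
    have h2 : φ ^ (1 / Q) ≤ 1 / (8 * C₁) := by
      refine (Real.rpow_le_rpow hφ0.le (min_le_right _ _) (by positivity)).trans_eq ?_
      rw [one_div Q, Real.rpow_rpow_inv (by positivity) hQ0.ne']
    refine (mul_le_mul_of_nonneg_left h2 hC₁.le).trans_eq ?_
    field_simp
  obtain ⟨p₁, hp₁, q₁, hq₁, ℓ₁, hℓ₁, hj₁⟩ := hlocal x s φ hs0 hφ0 hRd ρ hρ.1 hlt.le E
    (arclengthCurve γ '' Icc 0 (pathLength γ).toReal)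
    ⟨hEc.isClosed, hEconn.isPreconnected, ⟨x, hx, by simp [hs0.le]⟩, qE, hqE, by linarith⟩
    (crosses_image hcurve hm0 hm1 h0.le (by
      linarith [dist_triangle_left x y (arclengthCurve γ (pathLength γ).toReal)]))
  obtain ⟨p₂, hp₂, q₂, hq₂, ℓ₂, hℓ₂, hj₂⟩ := hlocal y s φ hs0 hφ0 hRd ρ hρ.1 hlt.le
    (arclengthCurve γ '' Icc 0 (pathLength γ).toReal) F
    (crosses_image hcurve hm1 hm0 h1.le (by
      linarith [dist_triangle_left x y (arclengthCurve γ 0)]))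
    ⟨hFc.isClosed, hFconn.isPreconnected, ⟨y, hy, by simp [hs0.le]⟩, qF, hqF, by linarith⟩
  obtain ⟨ℓ₀, hℓ₀, hj₀⟩ := exists_joinedByCurve_image ρ hcurve hq₁ hp₂
  obtain ⟨f, hf, hf0, hf1, hfρ⟩ := (hj₁.trans hℓ₁ hℓ₀ hj₀).trans (add_nonneg hℓ₁ hℓ₀) hℓ₂ hj₂
  obtain ⟨γ', hγ0, hγ1, hγr', hγρ'⟩ := exists_path_of_lipschitzWith hρ.1 hf
    (add_nonneg (add_nonneg hℓ₁ hℓ₀) hℓ₂)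
  have hone := hρ.2 γ' ⟨by rw [hγ0, hf0]; exact hp₁, by rw [hγ1, hf1]; exact hq₂⟩ hγr'
  have hfin : lineIntegral ρ γ' ≤ ENNReal.ofReal (1 / 8 + 1 / 4 + 1 / 8) := by
    refine hγρ'.trans (hfρ.trans ?_)
    rw [ENNReal.ofReal_add (by norm_num) (by norm_num),
      ENNReal.ofReal_add (by norm_num) (by norm_num)]
    exact add_le_add (add_le_add (ENNReal.ofReal_le_ofReal hφ1) hγρ)
      (ENNReal.ofReal_le_ofReal hφ1)
  have := ENNReal.one_le_ofReal.1 (hone.trans hfin)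
  norm_num at this

end Modulus

/-! ### Connectedness of the space. -/

section Connectedness

variable [MeasurableSpace Z]

/-- An isolated point would have positive mass, while the balls around it, equal to the point, have
mass at most `C * R ^ Q`, which tends to `0`. -/
lemma exists_ne_dist_lt {μ : Measure Z} [μ.IsOpenPosMeasure] {Q C : ℝ} (hQ : 0 < Q)
    (hup : ∀ (a : Z) (R : ℝ), 0 < R → ENNReal.ofReal R ≤ Metric.ediam (univ : Set Z) →
      μ (Metric.ball a R) ≤ ENNReal.ofReal (C * R ^ Q)) [Nontrivial Z] (a : Z) {s : ℝ}
    (hs : 0 < s) : ∃ b, b ≠ a ∧ dist b a < s := by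
  by_contra! h
  obtain ⟨D, hD, hDd⟩ : ∃ D : ℝ, 0 < D ∧ ENNReal.ofReal D ≤ Metric.ediam (univ : Set Z) := by
    obtain ⟨b, hb⟩ := exists_ne a
    refine ⟨dist b a, dist_pos.2 hb, ?_⟩
    rw [← edist_dist]
    exact Metric.edist_le_ediam_of_mem (mem_univ _) (mem_univ _)
  have hball : ∀ R ≤ s, 0 < R → Metric.ball a R = {a} := by
    intro R hR hR0
    refine Subset.antisymm (fun b hb ↦ ?_) (by simpa using hR0)
    by_contra hba
    exact absurd (h b hba) (not_le.2 (hb.trans_le hR))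
  have hpos : 0 < μ {a} := by
    rw [← hball s le_rfl hs]
    exact Metric.measure_ball_pos μ a hs
  have hlim : Tendsto (fun R : ℝ ↦ ENNReal.ofReal (C * R ^ Q)) (𝓝[>] 0) (𝓝 0) := by
    have h1 : Tendsto (fun R : ℝ ↦ C * R ^ Q) (𝓝[>] 0) (𝓝 (C * 0 ^ Q)) :=
      (((Real.continuousAt_rpow_const 0 Q (Or.inr hQ.le)).tendsto).mono_left
        nhdsWithin_le_nhds).const_mul C
    rw [Real.zero_rpow hQ.ne', mul_zero] at h1
    simpa using ENNReal.tendsto_ofReal h1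
  refine absurd (ge_of_tendsto hlim ?_) (not_le.2 hpos)
  filter_upwards [Ioc_mem_nhdsGT (lt_min hs hD)] with R hR
  rw [← hball R (hR.2.trans (min_le_left _ _)) hR.1]
  exact hup a R hR.1 ((ENNReal.ofReal_le_ofReal (hR.2.trans (min_le_right _ _))).trans hDd)

/-- Any two distinct points have arbitrarily small neighbourhoods that are connected by a path. -/
lemma BallLoewner.exists_path {μ : Measure Z} {Q : ℝ} (hQ : 0 < Q) {Ψ : ℝ → ℝ}
    (hΨ : IsLoewnerFunction Ψ) (hb : BallLoewner Q μ Ψ)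
    (hacc : ∀ (a : Z) (s : ℝ), 0 < s → ∃ b, b ≠ a ∧ dist b a < s) {x y : Z} (hxy : x ≠ y) {s : ℝ}
    (hs : 0 < s) : (connectingPaths (Metric.ball x s) (Metric.ball y s)).Nonempty := by
  set t := min s (dist x y / 3) with ht
  have ht0 : 0 < t := lt_min hs (div_pos (dist_pos.2 hxy) (by norm_num))
  have hdpos : ∀ a : Z, Metric.ediam (Metric.ball a t) ≠ 0 := by
    intro a
    obtain ⟨b, hba, hbt⟩ := hacc a t ht0
    exact (Metric.ediam_pos_iff.2 ⟨b, hbt, a, Metric.mem_ball_self ht0, hba⟩).ne'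
  have h3 : 3 * t ≤ dist x y := by
    have := min_le_right s (dist x y / 3)
    linarith
  have hd0 : setDist (Metric.ball x t) (Metric.ball y t) ≠ 0 :=
    ((ENNReal.ofReal_pos.2 ht0).trans_le (ofReal_le_setDist_ball h3)).ne'
  have hdt : setDist (Metric.ball x t) (Metric.ball y t) ≠ ∞ :=
    ne_top_of_le_ne_top (edist_ne_top x y)
      (setDist_le (Metric.mem_ball_self ht0) (Metric.mem_ball_self ht0))
  -- As `toReal` sends `∞` to `0`, positivity also requires a finite quotient, that is, balls of
  -- positive diameter; this is where the absence of isolated points enters.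
  have hpos : 0 < relDist (Metric.ball x t) (Metric.ball y t) := by
    refine ENNReal.toReal_pos (ENNReal.div_pos hd0 ?_).ne' (ENNReal.div_ne_top hdt ?_)
    · exact ne_top_of_le_ne_top Metric.isBounded_ball.ediam_ne_top (min_le_left _ _)
    · exact (lt_min (pos_iff_ne_zero.2 (hdpos x)) (pos_iff_ne_zero.2 (hdpos y))).ne'
  have hmod := hb x y t t ht0 ht0 (Metric.ball_disjoint_ball (by linarith)) hpos
  by_contra hne
  rw [not_nonempty_iff_eq_empty] at hne
  have hempty : connectingPaths (Metric.ball x t) (Metric.ball y t) = ∅ := by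
    refine eq_empty_of_forall_notMem fun γ hγ ↦ ?_
    have : γ ∈ connectingPaths (Metric.ball x s) (Metric.ball y s) :=
      ⟨Metric.ball_subset_ball (min_le_left _ _) hγ.1,
        Metric.ball_subset_ball (min_le_left _ _) hγ.2⟩
    rw [hne] at this
    exact this
  rw [hempty] at hmod
  have hadm : IsAdmissible (∅ : Set C(I, Z)) (fun _ ↦ 0) :=
    ⟨measurable_const, fun γ hγ ↦ absurd hγ (notMem_empty γ)⟩
  have h0 := hmod.trans (modulus_le hadm)
  rw [ENNReal.zero_rpow_of_pos hQ, lintegral_zero, nonpos_iff_eq_zero, ENNReal.ofReal_eq_zero]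
    at h0
  exact absurd (hΨ.1 _ hpos) (not_lt.2 h0)

lemma BallLoewner.connectedSpace [Nonempty Z] {μ : Measure Z} [μ.IsOpenPosMeasure] {Q C : ℝ}
    (hQ : 0 < Q)
    (hup : ∀ (a : Z) (R : ℝ), 0 < R → ENNReal.ofReal R ≤ Metric.ediam (univ : Set Z) →
      μ (Metric.ball a R) ≤ ENNReal.ofReal (C * R ^ Q)) {Ψ : ℝ → ℝ} (hΨ : IsLoewnerFunction Ψ)
    (hb : BallLoewner Q μ Ψ) : ConnectedSpace Z := by
  have : PreconnectedSpace Z := by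
    rw [preconnectedSpace_iff_clopen]
    intro U hU
    by_contra! hcon
    obtain ⟨x, hx⟩ := hcon.1
    obtain ⟨y, hy⟩ := (ne_univ_iff_exists_notMem U).1 hcon.2
    have hxy : x ≠ y := fun h ↦ hy (h ▸ hx)
    have : Nontrivial Z := ⟨x, y, hxy⟩
    obtain ⟨s, hs, hsU⟩ := Metric.isOpen_iff.1 hU.isOpen x hx
    obtain ⟨t, ht, htU⟩ := Metric.isOpen_iff.1 hU.compl.isOpen y hy
    obtain ⟨γ, hγ0, hγ1⟩ := hb.exists_path hQ hΨ (fun a s hs ↦ exists_ne_dist_lt hQ hup a hs) hxy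
      (lt_min hs ht)
    have h0 : γ 0 ∈ U := hsU (Metric.ball_subset_ball (min_le_left _ _) hγ0)
    have h1 : γ 1 ∉ U := htU (Metric.ball_subset_ball (min_le_right _ _) hγ1)
    rcases isClopen_iff.1 (hU.preimage γ.continuous) with h | h
    · exact (h ▸ h0 : (0 : I) ∈ (∅ : Set I))
    · exact h1 (show (1 : I) ∈ γ ⁻¹' U from h ▸ mem_univ _)
  exact { toPreconnectedSpace := this, toNonempty := inferInstance }

end Connectedness

end MetricMeasure

end

/-- The Loewner condition need only be checked for pairs of balls. Since the function `Ψ` lives on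
`(0, ∞)`, the assumption concerns disjoint balls with positive relative distance. -/
theorem corollary3p2 {Z : Type*} [MetricSpace Z] [Nonempty Z] [CompleteSpace Z]
    [LocallyCompactSpace Z] [MeasurableSpace Z] [BorelSpace Z]
    (μ : MeasureTheory.Measure Z) [MeasureTheory.IsLocallyFiniteMeasure μ] [μ.IsOpenPosMeasure]
    (Q : ℝ) (hQ : 1 < Q) (hreg : MetricMeasure.IsAhlforsRegular Q μ)
    (hball : ∃ Ψ : ℝ → ℝ, MetricMeasure.IsLoewnerFunction Ψ ∧
      ∀ (a b : Z) (r s : ℝ), 0 < r → 0 < s →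
        Disjoint (Metric.ball a r) (Metric.ball b s) →
        0 < MetricMeasure.relDist (Metric.ball a r) (Metric.ball b s) →
        ENNReal.ofReal (Ψ (MetricMeasure.relDist (Metric.ball a r) (Metric.ball b s))) ≤
          MetricMeasure.modulus Q μ
            (MetricMeasure.connectingPaths (Metric.ball a r) (Metric.ball b s))) :
    MetricMeasure.IsLoewner Q μ := by
  obtain ⟨C, hC, hreg⟩ := hreg
  obtain ⟨Ψ, hΨ, hball⟩ := hball
  have hup := fun a R hR hRd ↦ (hreg a R hR hRd).2
  obtain ⟨Φ, hΦ, hmod⟩ := MetricMeasure.exists_loewnerFunction hQ (by linarith) hup hΨ hball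
  exact ⟨MetricMeasure.BallLoewner.connectedSpace (by linarith) hup hΨ hball, Φ, hΦ,
    fun E F hE hF _ ↦ hmod E F hE hF⟩
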